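/- Let $m,n,s\ge 0$ be integers and let $f_{ij}$ ($1\le i\le n$, $1\le j\le m$) and $g_1,\dots,g_s$ be polynomials in $\mathbb{C}[\mathbf{y}]=\mathbb{C}[y_1,\dots,y_n]$. Consider the autonomous differential-algebraic Pfaffian system $$\Sigma:\qquad \frac{\partial y_i}{\partial x_j}=f_{ij}(\mathbf{y})\ \ (1\le i\le n,\ 1\le j\le m),\qquad g_k(\mathbf{y})=0\ \ (1\le k\le s).$$ A solution of $\Sigma$ is an analytic map $\gamma:U\to\mathbb{C}^n$ on a nonempty open set $U\subseteq\mathbb{C}^m$ with $\partial\gamma_i/\partial x_j=f_{ij}(\gamma)$ and $g_k(\gamma)=0$ on $U$ for all $i,j,k$; $\Sigma$ is called integrable if it has a solution. For $h\in\mathbb{C}[\mathbf{y}]$ put $D_j(h)=\sum_{i=1}^n \frac{\partial h}{\partial y_i}f_{ij}$. Let $\mathfrak{F}\subseteq\mathbb{C}[\mathbf{y}]$ be the ideal generated by the polynomials $D_j(f_{ik})-D_k(f_{ij})$ for $1\le i\le n$, $1\le j,k\le m$. For an ideal $I\subseteq \mathbb{C}[\mathbf{y}]$, let $\widetilde{I}$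 be the ideal generated by $I$ and all $D_j(h)$ with $h\in I$, $1\le j\le m$ (equivalently, with $h$ running through any system of generators of $I$). Put $$\mathcal{I}=\sqrt{(g_1,\dots,g_s)},\qquad \mathcal{J}=\sqrt{\mathfrak{F}+\widetilde{\mathcal{I}}},$$ and let $\mathbb{V}\supseteq\mathbb{W}$ be the sets of zeros in $\mathbb{C}^n$ of $\mathcal{I}$ and $\mathcal{J}$ respectively. Suppose that $Q\in\mathbb{C}^n$ is a regular point of both $\mathbb{V}$ and $\mathbb{W}$ (that is, $Q$ lies on both and the local rings of both varieties at $Q$ are regular) and that $\mathbb{V}\cap N=\mathbb{W}\cap N$ for some neighborhood $N$ of $Q$ in $\mathbb{C}^n$ (in the usual topology). Then $\Sigma$ is integrable. Moreover, there is a solution $\gamma:U\to\mathbb{C}^n$ of $\Sigma$ with $Q\in\gamma(U)$ and $\gamma(U)\subseteq\mathbb{W}$. -/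

import Mathlib

open Topology

/-- An autonomous differential-algebraic Pfaffian system
`∂yᵢ/∂xⱼ = fᵢⱼ(y)`, `gₖ(y) = 0`, with `m` independent variables, `n` unknowns and
`s` algebraic constraints, given by polynomials in `ℂ[y₁, …, yₙ]`. -/
structure PfaffianSystem (m n s : ℕ) where
  /-- the right-hand sides `fᵢⱼ` -/
  f : Fin n → Fin m → MvPolynomial (Fin n) ℂ
  /-- the algebraic constraints `gₖ` -/
  g : Fin s → MvPolynomial (Fin n) ℂ

namespace PfaffianSystem

variable {m n s : ℕ} (S : PfaffianSystem m n s)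

/-- The total derivative `D_j(h) = ∑ᵢ (∂h/∂yᵢ) fᵢⱼ` induced by the system. -/
noncomputable def totalDeriv (j : Fin m) (h : MvPolynomial (Fin n) ℂ) :
    MvPolynomial (Fin n) ℂ :=
  ∑ i : Fin n, MvPolynomial.pderiv i h * S.f i j

/-- The ideal generated by the Frobenius conditions `D_j(f_{ik}) - D_k(f_{ij})`. -/
noncomputable def frobeniusIdeal : Ideal (MvPolynomial (Fin n) ℂ) :=
  Ideal.span {p | ∃ (i : Fin n) (j k : Fin m),
    p = S.totalDeriv j (S.f i k) - S.totalDeriv k (S.f i j)}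

/-- The prolongation of an ideal `I`: the ideal generated by `I` and all `D_j(h)` with `h ∈ I`.
By `prolongation_eq_of_span_eq` it suffices to let `h` run through any system of generators
of `I`. -/
noncomputable def prolongation (I : Ideal (MvPolynomial (Fin n) ℂ)) :
    Ideal (MvPolynomial (Fin n) ℂ) :=
  I ⊔ Ideal.span {p | ∃ (j : Fin m), ∃ h ∈ I, p = S.totalDeriv j h}

theorem prolongation_eq_of_span_eq {I : Ideal (MvPolynomial (Fin n) ℂ)}
    {G : Set (MvPolynomial (Fin n) ℂ)} (hG : Ideal.span G = I) :
    S.prolongation I = I ⊔ Ideal.span {p | ∃ (j : Fin m), ∃ h ∈ G, p = S.totalDeriv j h} := by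
  apply le_antisymm
  · refine sup_le le_sup_left (Ideal.span_le.2 ?_)
    rintro _ ⟨j, h, hh, rfl⟩
    rw [← hG] at hh
    rw [SetLike.mem_coe]
    induction hh using Submodule.span_induction with
    | mem x hx => exact Ideal.mem_sup_right (Ideal.subset_span ⟨j, x, hx, rfl⟩)
    | zero => simp [totalDeriv]
    | add x y _ _ hx hy =>
      have : S.totalDeriv j (x + y) = S.totalDeriv j x + S.totalDeriv j y := by
        simp [totalDeriv, add_mul, Finset.sum_add_distrib]
      rw [this]
      exact Ideal.add_mem _ hx hy
    | smul a x hxG hx =>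
      have : S.totalDeriv j (a • x) = a * S.totalDeriv j x + S.totalDeriv j a * x := by
        simp only [totalDeriv, smul_eq_mul, Derivation.leibniz, Finset.mul_sum, Finset.sum_mul,
          ← Finset.sum_add_distrib]
        exact Finset.sum_congr rfl fun i _ => by ring
      rw [this]
      refine Ideal.add_mem _ (Ideal.mul_mem_left _ _ hx) (Ideal.mul_mem_left _ _ ?_)
      exact Ideal.mem_sup_left (hG ▸ hxG)
  · refine sup_le_sup_left (Ideal.span_mono ?_) _
    rintro _ ⟨j, h, hh, rfl⟩
    exact ⟨j, h, hG ▸ Ideal.subset_span hh, rfl⟩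

/-- The radical `𝓘 = √(g)` of the ideal of the algebraic constraints. -/
noncomputable def idealI : Ideal (MvPolynomial (Fin n) ℂ) :=
  (Ideal.span (Set.range S.g)).radical

/-- The radical `𝓙 = √(𝔉 + 𝓘~)`, where `𝓘~` is the prolongation of `𝓘`. -/
noncomputable def idealJ : Ideal (MvPolynomial (Fin n) ℂ) :=
  (S.frobeniusIdeal ⊔ S.prolongation S.idealI).radical

/-- The variety `𝕍 ⊆ ℂⁿ` of `𝓘`. -/
noncomputable def varietyV : Set (Fin n → ℂ) :=
  MvPolynomial.zeroLocus ℂ S.idealI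

/-- The variety `𝕎 ⊆ ℂⁿ` of `𝓙`. -/
noncomputable def varietyW : Set (Fin n → ℂ) :=
  MvPolynomial.zeroLocus ℂ S.idealJ

/-- `γ` is an analytic solution of the system on the nonempty open set `U ⊆ ℂᵐ`. -/
structure IsSolution (U : Set (Fin m → ℂ)) (γ : (Fin m → ℂ) → (Fin n → ℂ)) : Prop where
  isOpen : IsOpen U
  nonempty : U.Nonempty
  analytic : AnalyticOnNhd ℂ γ U
  /-- the differential equations: `∂γᵢ/∂xⱼ = fᵢⱼ(γ)` on `U` -/
  deriv_eq : ∀ x ∈ U, ∀ (i : Fin n) (j : Fin m),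
    fderiv ℂ γ x (Pi.single j 1) i = MvPolynomial.eval (γ x) (S.f i j)
  /-- the algebraic constraints: `gₖ(γ) = 0` on `U` -/
  constraint : ∀ x ∈ U, ∀ k : Fin s, MvPolynomial.eval (γ x) (S.g k) = 0

/-- The system is integrable: it has an analytic solution on some nonempty open set. -/
def IsIntegrable : Prop :=
  ∃ (U : Set (Fin m → ℂ)) (γ : (Fin m → ℂ) → (Fin n → ℂ)), S.IsSolution U γ

end PfaffianSystem

/-- `Q` is a regular (nonsingular) point of the algebraic variety `V ⊆ ℂⁿ`: it lies on `V`, and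
the local ring `𝒪_{V,Q} = ℂ[y]_{𝔪_Q} / I(V) ℂ[y]_{𝔪_Q}` of `V` at `Q` is a regular local ring.
Here `𝔪_Q` is the maximal ideal of the polynomials vanishing at `Q`, and `I(V)` the ideal of the
polynomials vanishing on `V`. -/
def IsRegularPoint {n : ℕ} (V : Set (Fin n → ℂ)) (Q : Fin n → ℂ) : Prop :=
  Q ∈ V ∧ IsRegularLocalRing
    (Localization.AtPrime (MvPolynomial.vanishingIdeal ℂ {Q}) ⧸
      (MvPolynomial.vanishingIdeal ℂ V).map
        (algebraMap (MvPolynomial (Fin n) ℂ)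
          (Localization.AtPrime (MvPolynomial.vanishingIdeal ℂ {Q}))))

namespace MvPolynomial

/-- The gradient of a polynomial at a point. -/
noncomputable def gradientAt {n : ℕ} (z : Fin n → ℂ) :
    MvPolynomial (Fin n) ℂ →ₗ[ℂ] (Fin n → ℂ) :=
  LinearMap.pi fun i => (aeval z).toLinearMap ∘ₗ (pderiv i).toLinearMap

theorem gradientAt_apply {n : ℕ} (z : Fin n → ℂ) (p : MvPolynomial (Fin n) ℂ) (i : Fin n) :
    gradientAt z p i = eval z (pderiv i p) := by
  simp [gradientAt]

theorem gradientAt_mul {n : ℕ} (z : Fin n → ℂ) (p q : MvPolynomial (Fin n) ℂ) :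
    gradientAt z (p * q) = eval z p • gradientAt z q + eval z q • gradientAt z p := by
  ext i
  simp [gradientAt_apply, Derivation.leibniz]

theorem hasStrictFDerivAt_eval {n : ℕ} (p : MvPolynomial (Fin n) ℂ) (z : Fin n → ℂ) :
    HasStrictFDerivAt (fun w => eval w p)
      (∑ i, gradientAt z p i • (ContinuousLinearMap.proj i : (Fin n → ℂ) →L[ℂ] ℂ)) z := by
  induction p using MvPolynomial.induction_on with
  | C a =>
    simp only [eval_C]
    refine (hasStrictFDerivAt_const (𝕜 := ℂ) a z).congr_fderiv ?_
    ext j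
    simp [gradientAt_apply]
  | add p q hp hq =>
    simp only [map_add]
    refine (hp.add hq).congr_fderiv ?_
    ext j
    simp [add_mul, Finset.sum_add_distrib]
  | mul_X p i hp =>
    have hX := (ContinuousLinearMap.proj i : (Fin n → ℂ) →L[ℂ] ℂ).hasStrictFDerivAt (x := z)
    have := hp.mul hX
    simp only [map_mul, eval_X]
    refine this.congr_fderiv ?_
    ext j
    simp [gradientAt_apply, pderiv_X, Pi.single_apply, add_mul,
      Finset.sum_add_distrib, Finset.mul_sum, mul_assoc, apply_ite (eval z)]

theorem continuous_eval_left {n : ℕ} (p : MvPolynomial (Fin n) ℂ) :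
    Continuous fun w : Fin n → ℂ => eval w p :=
  continuous_iff_continuousAt.2 fun z => (hasStrictFDerivAt_eval p z).hasFDerivAt.continuousAt

theorem hasDerivAt_eval_line {n : ℕ} (p : MvPolynomial (Fin n) ℂ) (z w : Fin n → ℂ) (t : ℂ) :
    HasDerivAt (fun t : ℂ => eval (z + t • w) p)
      (∑ i, eval (z + t • w) (pderiv i p) * w i) t := by
  have h1 : HasDerivAt (fun t : ℂ => z + t • w) w t := by
    simpa using ((hasDerivAt_id t).smul_const w).const_add z
  have := (hasStrictFDerivAt_eval p (z + t • w)).hasFDerivAt.comp_hasDerivAt t h1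
  simpa [gradientAt_apply, Function.comp_def] using this

/-- Cauchy's estimate for the directional derivative of a polynomial. -/
theorem norm_directional_deriv_le {n : ℕ} (p : MvPolynomial (Fin n) ℂ) (Q z w : Fin n → ℂ)
    {ρ δ M c : ℝ} (hδ : 0 < δ) (hz : z ∈ Metric.closedBall Q ρ) (hw : ‖w‖ ≤ c)
    (hM : ∀ y ∈ Metric.closedBall Q (ρ + δ), ‖eval y p‖ ≤ M) :
    ‖∑ i, eval z (pderiv i p) * w i‖ ≤ M * (c / δ) := by
  have hM0 : 0 ≤ M := (norm_nonneg _).trans (hM z (Metric.closedBall_subset_closedBall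
    (by linarith) hz))
  have hc : 0 ≤ c := (norm_nonneg w).trans hw
  rcases hc.eq_or_lt with rfl | hc
  · have : w = 0 := by simpa using hw
    simp [this]
  have h := Complex.norm_deriv_le_of_forall_mem_sphere_norm_le (c := 0) (R := δ / c) (C := M)
    (f := fun t : ℂ => eval (z + t • w) p) (by positivity)
    (Differentiable.diffContOnCl fun t => (hasDerivAt_eval_line p z w t).differentiableAt) ?_
  · rw [(hasDerivAt_eval_line p z w 0).deriv] at h
    simpa [div_div_eq_mul_div, mul_div_assoc] using h
  · intro t ht
    refine hM _ ?_
    rw [mem_closedBall_iff_norm] at hz ⊢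
    have ht' : ‖t‖ = δ / c := by simpa using ht
    calc ‖z + t • w - Q‖ = ‖(z - Q) + t • w‖ := by congr 1; abel
      _ ≤ ‖z - Q‖ + ‖t • w‖ := norm_add_le _ _
      _ ≤ ρ + δ / c * c := by
        rw [norm_smul, ht']; gcongr
      _ = ρ + δ := by field_simp

end MvPolynomial

namespace PfaffianSystem

open MvPolynomial

variable {m n s : ℕ} (S : PfaffianSystem m n s)

/-- The total derivative `D_j` as a linear map. -/
noncomputable def totalDerivLinear (j : Fin m) : Module.End ℂ (MvPolynomial (Fin n) ℂ) where
  toFun := S.totalDeriv j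
  map_add' p q := by simp [totalDeriv, add_mul, Finset.sum_add_distrib]
  map_smul' c p := by simp [totalDeriv, Finset.smul_sum]

theorem totalDerivLinear_apply (j : Fin m) (p : MvPolynomial (Fin n) ℂ) :
    S.totalDerivLinear j p = S.totalDeriv j p := rfl

/-- The total derivative in the direction `v`, linear in `v`. -/
noncomputable def derivEnd : (Fin m → ℂ) →ₗ[ℂ] Module.End ℂ (MvPolynomial (Fin n) ℂ) :=
  ∑ j, (LinearMap.proj j).smulRight (S.totalDerivLinear j)

theorem derivEnd_apply (v : Fin m → ℂ) (p : MvPolynomial (Fin n) ℂ) :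
    S.derivEnd v p = ∑ j, v j • S.totalDeriv j p := by
  simp [derivEnd, totalDerivLinear_apply]

theorem totalDeriv_mul (j : Fin m) (p q : MvPolynomial (Fin n) ℂ) :
    S.totalDeriv j (p * q) = p * S.totalDeriv j q + S.totalDeriv j p * q := by
  simp only [totalDeriv, smul_eq_mul, Derivation.leibniz, Finset.mul_sum, Finset.sum_mul,
    ← Finset.sum_add_distrib]
  exact Finset.sum_congr rfl fun i _ => by ring

theorem derivEnd_mul (v : Fin m → ℂ) (p q : MvPolynomial (Fin n) ℂ) :
    S.derivEnd v (p * q) = p * S.derivEnd v q + S.derivEnd v p * q := by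
  simp [derivEnd_apply, totalDeriv_mul, Finset.sum_add_distrib, Finset.mul_sum, Finset.sum_mul]

theorem derivEnd_single (j : Fin m) (p : MvPolynomial (Fin n) ℂ) :
    S.derivEnd (Pi.single j 1) p = S.totalDeriv j p := by
  simp [derivEnd_apply, Pi.single_apply]

theorem eval_derivEnd (v : Fin m → ℂ) (p : MvPolynomial (Fin n) ℂ) (z : Fin n → ℂ) :
    eval z (S.derivEnd v p) =
      ∑ i, eval z (pderiv i p) * (∑ j, v j * eval z (S.f i j)) := by
  simp [derivEnd_apply, totalDeriv, smul_eval, Finset.mul_sum]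
  rw [Finset.sum_comm]
  refine Finset.sum_congr rfl fun i _ => Finset.sum_congr rfl fun j _ => by ring

theorem exists_vectorField_bound (Q : Fin n → ℂ) :
    ∃ c > 0, ∀ z ∈ Metric.closedBall Q 1, ∀ v : Fin m → ℂ,
      ‖fun i => ∑ j, v j * eval z (S.f i j)‖ ≤ c * ‖v‖ := by
  have hb : ∀ i j, ∃ b, ∀ z ∈ Metric.closedBall Q 1, ‖eval z (S.f i j)‖ ≤ b := fun i j =>
    (isCompact_closedBall Q 1).exists_bound_of_continuousOn
      (continuous_eval_left (S.f i j)).continuousOn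
  choose b hb using hb
  have hQ : Q ∈ Metric.closedBall Q 1 := Metric.mem_closedBall_self zero_le_one
  have hb0 : ∀ i j, 0 ≤ b i j := fun i j => (norm_nonneg _).trans (hb i j Q hQ)
  have hs : 0 ≤ ∑ i, ∑ j, b i j := Finset.sum_nonneg fun i _ => Finset.sum_nonneg fun j _ => hb0 i j
  refine ⟨∑ i, ∑ j, b i j + 1, by positivity, fun z hz v => ?_⟩
  rw [pi_norm_le_iff_of_nonneg (by positivity)]
  intro i
  calc ‖∑ j, v j * eval z (S.f i j)‖ ≤ ∑ j, ‖v j * eval z (S.f i j)‖ := norm_sum_le _ _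
    _ ≤ ∑ j, b i j * ‖v‖ := Finset.sum_le_sum fun j _ => by
        rw [norm_mul, mul_comm]
        exact mul_le_mul (hb i j z hz) (norm_le_pi_norm v j) (norm_nonneg _) (hb0 i j)
    _ = (∑ j, b i j) * ‖v‖ := by rw [Finset.sum_mul]
    _ ≤ (∑ i, ∑ j, b i j + 1) * ‖v‖ := by
        gcongr
        have := Finset.single_le_sum (f := fun i => ∑ j, b i j)
          (fun i _ => Finset.sum_nonneg fun j _ => hb0 i j) (Finset.mem_univ i)
        linarith

theorem norm_eval_derivEnd_prod_le {Q : Fin n → ℂ} {c : ℝ}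
    (hc : ∀ z ∈ Metric.closedBall Q 1, ∀ v : Fin m → ℂ,
      ‖fun i => ∑ j, v j * eval z (S.f i j)‖ ≤ c * ‖v‖)
    (p : MvPolynomial (Fin n) ℂ) {M δ : ℝ} (hδ : 0 < δ)
    (hM : ∀ z ∈ Metric.closedBall Q 1, ‖eval z p‖ ≤ M) (l : List (Fin m → ℂ)) :
    ∀ ρ : ℝ, ρ + l.length * δ ≤ 1 → ∀ z ∈ Metric.closedBall Q ρ,
      ‖eval z ((l.map S.derivEnd).prod p)‖ ≤ M * ((c / δ) ^ l.length * (l.map norm).prod) := by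
  induction l with
  | nil =>
    intro ρ hρ z hz
    simp only [List.length_nil, Nat.cast_zero, zero_mul, add_zero] at hρ
    simpa using hM z (Metric.closedBall_subset_closedBall hρ hz)
  | cons v l ih =>
    intro ρ hρ z hz
    simp only [List.length_cons, Nat.cast_add, Nat.cast_one] at hρ
    have h := ih (ρ + δ) (by linarith)
    have hz1 : z ∈ Metric.closedBall Q 1 := by
      refine Metric.closedBall_subset_closedBall ?_ hz
      have : 0 ≤ (l.length : ℝ) * δ := by positivity
      linarith
    simp only [List.map_cons, List.prod_cons, Module.End.mul_apply, eval_derivEnd]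
    refine (norm_directional_deriv_le _ Q z _ hδ hz (hc z hz1 v) h).trans_eq ?_
    simp only [List.length_cons, pow_succ]
    ring

/-- Growth of the iterated total derivatives at a point. -/
theorem exists_norm_eval_derivEnd_prod_le (Q : Fin n → ℂ) :
    ∃ K > 0, ∀ p : MvPolynomial (Fin n) ℂ, ∃ M, ∀ l : List (Fin m → ℂ),
      ‖eval Q ((l.map S.derivEnd).prod p)‖ ≤
        M * (l.length.factorial * (K ^ l.length * (l.map norm).prod)) := by
  obtain ⟨c, hc0, hc⟩ := S.exists_vectorField_bound Q
  refine ⟨c * Real.exp 1, by positivity, fun p => ?_⟩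
  obtain ⟨M, hM⟩ := (isCompact_closedBall Q 1).exists_bound_of_continuousOn
    (continuous_eval_left p).continuousOn
  have hM0 : 0 ≤ M := (norm_nonneg _).trans (hM Q (Metric.mem_closedBall_self zero_le_one))
  refine ⟨M, fun l => ?_⟩
  rcases Nat.eq_zero_or_pos l.length with h0 | hpos
  · rw [List.length_eq_zero_iff] at h0
    subst h0
    simpa using hM Q (Metric.mem_closedBall_self zero_le_one)
  have hk : (0 : ℝ) < l.length := by exact_mod_cast hpos
  have hprod : 0 ≤ (l.map norm).prod := List.prod_nonneg (by simp)
  refine (S.norm_eval_derivEnd_prod_le hc p (δ := 1 / l.length) (by positivity) hM l 0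
    (by field_simp; simp) Q (Metric.mem_closedBall_self le_rfl)).trans ?_
  have h := Real.pow_div_factorial_le_exp (x := l.length) hk.le l.length
  rw [div_le_iff₀ (by positivity)] at h
  have : (c / (1 / (l.length : ℝ))) ^ l.length ≤
      l.length.factorial * (c * Real.exp 1) ^ l.length := by
    rw [div_div_eq_mul_div, div_one, mul_pow, mul_pow, ← Real.exp_nat_mul, mul_one]
    calc _ ≤ c ^ l.length * (Real.exp l.length * l.length.factorial) := by gcongr
      _ = _ := by ring
  rw [← mul_assoc (l.length.factorial : ℝ)]
  gcongr

end PfaffianSystem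

namespace PfaffianSystem

open MvPolynomial

variable {m n s : ℕ} (S : PfaffianSystem m n s)

/-- The term of order `k` of the Lie series of `p` at `Q`. -/
noncomputable def lieTerm (Q : Fin n → ℂ) (k : ℕ) (x : Fin m → ℂ) (p : MvPolynomial (Fin n) ℂ) :
    ℂ :=
  (k.factorial : ℂ)⁻¹ * eval Q ((S.derivEnd x ^ k) p)

/-- The Lie series of `p` at `Q`: the prospective value of `p` along the solution through `Q`. -/
noncomputable def lieSeries (Q : Fin n → ℂ) (x : Fin m → ℂ) (p : MvPolynomial (Fin n) ℂ) : ℂ :=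
  ∑' k, S.lieTerm Q k x p

theorem derivEnd_pow_mul (x : Fin m → ℂ) (k : ℕ) (p q : MvPolynomial (Fin n) ℂ) :
    (S.derivEnd x ^ k) (p * q) = ∑ ij ∈ Finset.HasAntidiagonal.antidiagonal k,
      k.choose ij.1 • ((S.derivEnd x ^ ij.1) p * (S.derivEnd x ^ ij.2) q) := by
  induction k with
  | zero => simp
  | succ k ih =>
    rw [pow_succ', Module.End.mul_apply, ih, map_sum,
      Finset.sum_antidiagonal_choose_succ_nsmul
        (fun i j => (S.derivEnd x ^ i) p * (S.derivEnd x ^ j) q), ← Finset.sum_add_distrib]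
    refine Finset.sum_congr rfl fun ij hij => ?_
    have hsymm : k.choose ij.2 = k.choose ij.1 := by
      rw [← Finset.HasAntidiagonal.mem_antidiagonal.1 hij]
      exact (Nat.choose_symm_add).symm
    rw [map_nsmul, derivEnd_mul, smul_add, pow_succ', pow_succ', Module.End.mul_apply,
      Module.End.mul_apply, hsymm]

theorem lieTerm_mul (Q : Fin n → ℂ) (k : ℕ) (x : Fin m → ℂ) (p q : MvPolynomial (Fin n) ℂ) :
    S.lieTerm Q k x (p * q) =
      ∑ ij ∈ Finset.HasAntidiagonal.antidiagonal k, S.lieTerm Q ij.1 x p * S.lieTerm Q ij.2 x q := by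
  rw [lieTerm, derivEnd_pow_mul, map_sum, Finset.mul_sum]
  refine Finset.sum_congr rfl fun ij hij => ?_
  obtain ⟨i, j⟩ := ij
  obtain rfl := Finset.HasAntidiagonal.mem_antidiagonal.1 hij
  have h : (((i + j).choose i : ℕ) : ℂ) * i.factorial * j.factorial = (i + j).factorial := by
    rw [Nat.choose_symm_add]
    exact_mod_cast Nat.add_choose_mul_factorial_mul_factorial i j
  have h1 : ((i + j).factorial : ℂ) ≠ 0 := by exact_mod_cast Nat.factorial_ne_zero _
  have h2 : (i.factorial : ℂ) ≠ 0 := by exact_mod_cast Nat.factorial_ne_zero _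
  have h3 : (j.factorial : ℂ) ≠ 0 := by exact_mod_cast Nat.factorial_ne_zero _
  simp only [lieTerm, map_mul, nsmul_eq_mul, map_natCast]
  field_simp
  rw [← h]
  ring

theorem lieTerm_add (Q : Fin n → ℂ) (k : ℕ) (x : Fin m → ℂ) (p q : MvPolynomial (Fin n) ℂ) :
    S.lieTerm Q k x (p + q) = S.lieTerm Q k x p + S.lieTerm Q k x q := by
  simp [lieTerm, mul_add]

theorem derivEnd_C (x : Fin m → ℂ) (a : ℂ) : S.derivEnd x (C a) = 0 := by
  simp [derivEnd_apply, totalDeriv]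

theorem lieSeries_C (Q : Fin n → ℂ) (x : Fin m → ℂ) (a : ℂ) :
    S.lieSeries Q x (C a) = a := by
  rw [lieSeries, tsum_eq_single 0]
  · simp [lieTerm]
  · intro k hk
    obtain ⟨k, rfl⟩ := Nat.exists_eq_succ_of_ne_zero hk
    simp [lieTerm, pow_succ, derivEnd_C]

theorem lieSeries_zero (Q : Fin n → ℂ) (p : MvPolynomial (Fin n) ℂ) :
    S.lieSeries Q 0 p = eval Q p := by
  rw [lieSeries, tsum_eq_single 0]
  · simp [lieTerm]
  · intro k hk
    simp [lieTerm, zero_pow hk]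

/-- The Lie series converge on a common ball, geometrically, to analytic functions. -/
theorem exists_lieSeries_convergence (Q : Fin n → ℂ) :
    ∃ r > 0, ∀ p : MvPolynomial (Fin n) ℂ,
      (∃ M, ∀ x ∈ Metric.ball (0 : Fin m → ℂ) r, ∀ k,
        ‖S.lieTerm Q k x p‖ ≤ M * (1 / 2) ^ k) ∧
      AnalyticOnNhd ℂ (fun x => S.lieSeries Q x p) (Metric.ball 0 r) := by
  obtain ⟨K, hK, hb⟩ := S.exists_norm_eval_derivEnd_prod_le Q
  refine ⟨1 / (2 * K), by positivity, fun p => ?_⟩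
  obtain ⟨M, hM⟩ := hb p
  have hM0 : 0 ≤ M := by simpa using (norm_nonneg _).trans (hM [])
  let φ (k : ℕ) : Module.End ℂ (MvPolynomial (Fin n) ℂ) →ₗ[ℂ] ℂ :=
    (k.factorial : ℂ)⁻¹ • ((aeval Q).toLinearMap ∘ₗ LinearMap.applyₗ p)
  let f (k : ℕ) : MultilinearMap ℂ (fun _ : Fin k => Fin m → ℂ) ℂ :=
    (φ k).compMultilinearMap
      ((MultilinearMap.mkPiAlgebraFin ℂ k (Module.End ℂ (MvPolynomial (Fin n) ℂ))).compLinearMap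
        fun _ => S.derivEnd)
  have hf (k : ℕ) (v : Fin k → Fin m → ℂ) : f k v =
      (k.factorial : ℂ)⁻¹ * eval Q (((List.ofFn v).map S.derivEnd).prod p) := by
    simp [f, φ, MultilinearMap.mkPiAlgebraFin_apply, List.map_ofFn, Function.comp_def]
  have hfb (k : ℕ) (v : Fin k → Fin m → ℂ) : ‖f k v‖ ≤ M * K ^ k * ∏ i, ‖v i‖ := by
    have h := hM (List.ofFn v)
    simp only [List.length_ofFn, List.map_ofFn, List.prod_ofFn, Function.comp_apply] at h
    rw [hf, norm_mul, norm_inv, Complex.norm_natCast, List.map_ofFn]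
    have hk : (0 : ℝ) < k.factorial := by exact_mod_cast Nat.factorial_pos k
    rw [inv_mul_le_iff₀ hk]
    refine h.trans_eq (by ring)
  have hterm (k : ℕ) (x : Fin m → ℂ) : S.lieTerm Q k x p = f k fun _ => x := by
    rw [hf, lieTerm, List.map_ofFn]
    simp [List.ofFn_const, Function.comp_def]
  let F : FormalMultilinearSeries ℂ (Fin m → ℂ) ℂ := fun k => (f k).mkContinuous (M * K ^ k) (hfb k)
  have hF (k : ℕ) : ‖F k‖ ≤ M * K ^ k :=
    MultilinearMap.mkContinuous_norm_le _ (by positivity) _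
  constructor
  · refine ⟨M, fun x hx k => ?_⟩
    rw [mem_ball_zero_iff] at hx
    rw [hterm]
    refine (hfb k _).trans ?_
    rw [Finset.prod_const, Finset.card_univ, Fintype.card_fin, mul_assoc, ← mul_pow]
    gcongr
    calc K * ‖x‖ ≤ K * (1 / (2 * K)) := by gcongr
      _ = 1 / 2 := by field_simp
  · obtain ⟨ρ, hρ⟩ : ∃ ρ : NNReal, (ρ : ℝ) = 1 / (2 * K) :=
      ⟨_, Real.coe_toNNReal _ (by positivity)⟩
    have hrad : (ρ : ENNReal) ≤ F.radius := by
      refine F.le_radius_of_bound M fun k => ?_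
      rw [hρ]
      calc ‖F k‖ * (1 / (2 * K)) ^ k ≤ M * K ^ k * (1 / (2 * K)) ^ k := by gcongr; exact hF k
        _ = M * (1 / 2) ^ k := by rw [mul_assoc, ← mul_pow]; congr 2; field_simp
        _ ≤ M * 1 := by gcongr; exact pow_le_one₀ (by norm_num) (by norm_num)
        _ = M := mul_one M
    have hpos : 0 < F.radius := lt_of_lt_of_le (by
      rw [ENNReal.coe_pos, ← NNReal.coe_pos, hρ]; positivity) hrad
    have han := (F.hasFPowerSeriesOnBall hpos).analyticOnNhd
    have hsum : F.sum = fun x => S.lieSeries Q x p := by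
      ext x
      simp only [FormalMultilinearSeries.sum, lieSeries, hterm]
      rfl
    rw [hsum] at han
    refine han.mono fun x hx => ?_
    rw [Metric.mem_eball]
    refine lt_of_lt_of_le ?_ hrad
    rw [edist_zero_right, enorm_eq_nnnorm, ENNReal.coe_lt_coe, ← NNReal.coe_lt_coe, hρ]
    simpa using hx

variable {S}

theorem lieSeries_mul {Q : Fin n → ℂ} {x : Fin m → ℂ}
    (hx : ∀ p, Summable fun k => ‖S.lieTerm Q k x p‖) (p q : MvPolynomial (Fin n) ℂ) :
    S.lieSeries Q x (p * q) = S.lieSeries Q x p * S.lieSeries Q x q := by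
  simp only [lieSeries, lieTerm_mul]
  exact (tsum_mul_tsum_eq_tsum_sum_antidiagonal_of_summable_norm (hx p) (hx q)).symm

theorem lieSeries_add {Q : Fin n → ℂ} {x : Fin m → ℂ}
    (hx : ∀ p, Summable fun k => ‖S.lieTerm Q k x p‖) (p q : MvPolynomial (Fin n) ℂ) :
    S.lieSeries Q x (p + q) = S.lieSeries Q x p + S.lieSeries Q x q := by
  simp only [lieSeries, lieTerm_add]
  exact (hx p).of_norm.tsum_add (hx q).of_norm

theorem lieSeries_eq_eval {Q : Fin n → ℂ} {x : Fin m → ℂ}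
    (hx : ∀ p, Summable fun k => ‖S.lieTerm Q k x p‖) (p : MvPolynomial (Fin n) ℂ) :
    S.lieSeries Q x p = eval (fun i => S.lieSeries Q x (X i)) p := by
  induction p using MvPolynomial.induction_on with
  | C a => rw [lieSeries_C, eval_C]
  | add p q hp hq => rw [lieSeries_add hx, hp, hq, map_add]
  | mul_X p i hp => rw [lieSeries_mul hx, hp, map_mul, eval_X]

variable (S)

theorem totalDeriv_X (j : Fin m) (i : Fin n) : S.totalDeriv j (X i) = S.f i j := by
  simp [totalDeriv, pderiv_X, Pi.single_apply]

theorem totalDeriv_comm_mem (j k : Fin m) (p : MvPolynomial (Fin n) ℂ) :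
    S.totalDeriv j (S.totalDeriv k p) - S.totalDeriv k (S.totalDeriv j p) ∈ S.frobeniusIdeal := by
  simp only [← totalDerivLinear_apply]
  induction p using MvPolynomial.induction_on with
  | C a => simp [totalDerivLinear_apply, totalDeriv]
  | add p q hp hq =>
    convert add_mem hp hq using 1
    simp only [map_add]
    ring
  | mul_X p i hp =>
    have hX : S.totalDerivLinear j (S.totalDerivLinear k (X i)) -
        S.totalDerivLinear k (S.totalDerivLinear j (X i)) ∈ S.frobeniusIdeal :=
      Ideal.subset_span ⟨i, j, k, by simp only [totalDerivLinear_apply, totalDeriv_X]⟩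
    have hmul (l : Fin m) (a b : MvPolynomial (Fin n) ℂ) : S.totalDerivLinear l (a * b) =
        a * S.totalDerivLinear l b + S.totalDerivLinear l a * b := S.totalDeriv_mul l a b
    convert add_mem (Ideal.mul_mem_left _ p hX) (Ideal.mul_mem_left _ (X i) hp) using 1
    simp only [hmul, map_add]
    ring

theorem derivEnd_mem {P : Ideal (MvPolynomial (Fin n) ℂ)}
    (hstab : ∀ j, ∀ p ∈ P, S.totalDeriv j p ∈ P) (v : Fin m → ℂ) {p : MvPolynomial (Fin n) ℂ}
    (hp : p ∈ P) : S.derivEnd v p ∈ P := by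
  rw [derivEnd_apply]
  exact sum_mem fun j _ => by
    rw [smul_eq_C_mul]; exact Ideal.mul_mem_left _ _ (hstab j p hp)

theorem derivEnd_pow_mem {P : Ideal (MvPolynomial (Fin n) ℂ)}
    (hstab : ∀ j, ∀ p ∈ P, S.totalDeriv j p ∈ P) (v : Fin m → ℂ) (k : ℕ)
    {p : MvPolynomial (Fin n) ℂ} (hp : p ∈ P) : (S.derivEnd v ^ k) p ∈ P := by
  induction k with
  | zero => simpa using hp
  | succ k ih => rw [pow_succ', Module.End.mul_apply]; exact S.derivEnd_mem hstab v ih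

theorem derivEnd_comm_mem (v w : Fin m → ℂ) (p : MvPolynomial (Fin n) ℂ) :
    S.derivEnd v (S.derivEnd w p) - S.derivEnd w (S.derivEnd v p) ∈ S.frobeniusIdeal := by
  have h (v w : Fin m → ℂ) : S.derivEnd v (S.derivEnd w p) =
      ∑ j, ∑ k, (v j * w k) • S.totalDeriv j (S.totalDeriv k p) := by
    simp only [S.derivEnd_apply v, ← totalDerivLinear_apply]
    simp only [derivEnd_apply, map_sum, map_smul, Finset.smul_sum, smul_smul,
      totalDerivLinear_apply]
  rw [h, h w v, Finset.sum_comm (γ := Fin m) (f := fun j k => (w j * v k) • _),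
    ← Finset.sum_sub_distrib]
  refine sum_mem fun j _ => ?_
  rw [← Finset.sum_sub_distrib]
  refine sum_mem fun k _ => ?_
  rw [mul_comm (w k), ← smul_sub, smul_eq_C_mul]
  exact Ideal.mul_mem_left _ _ (S.totalDeriv_comm_mem j k p)

theorem hasDerivAt_eval_derivEnd_pow {P : Ideal (MvPolynomial (Fin n) ℂ)} {Q : Fin n → ℂ}
    (hQ : ∀ p ∈ P, eval Q p = 0) (hstab : ∀ j, ∀ p ∈ P, S.totalDeriv j p ∈ P)
    (hfrob : S.frobeniusIdeal ≤ P) (x v : Fin m → ℂ) (k : ℕ) (p : MvPolynomial (Fin n) ℂ) (t : ℂ) :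
    HasDerivAt (fun t : ℂ => eval Q ((S.derivEnd (x + t • v) ^ (k + 1)) p))
      ((k + 1 : ℕ) * eval Q ((S.derivEnd (x + t • v) ^ k) (S.derivEnd v p))) t := by
  have hsplit (k : ℕ) (p : MvPolynomial (Fin n) ℂ) (t : ℂ) :
      eval Q ((S.derivEnd (x + t • v) ^ (k + 1)) p) =
        eval Q ((S.derivEnd (x + t • v) ^ k) (S.derivEnd x p)) +
        t * eval Q ((S.derivEnd (x + t • v) ^ k) (S.derivEnd v p)) := by
    rw [pow_succ, Module.End.mul_apply]
    conv_lhs => rw [map_add, map_smul, LinearMap.add_apply, LinearMap.smul_apply]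
    simp
  induction k generalizing p with
  | zero =>
    simp only [hsplit, pow_zero, Module.End.one_apply]
    simpa using ((hasDerivAt_id t).mul_const (eval Q (S.derivEnd v p))).const_add
      (eval Q (S.derivEnd x p))
  | succ k ih =>
    simp only [hsplit (k + 1)]
    refine ((ih (S.derivEnd x p)).add ((hasDerivAt_id t).mul (ih (S.derivEnd v p)))).congr_deriv ?_
    have hcomm : eval Q ((S.derivEnd (x + t • v) ^ k) (S.derivEnd v (S.derivEnd (x + t • v) p))) =
        eval Q ((S.derivEnd (x + t • v) ^ (k + 1)) (S.derivEnd v p)) := by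
      rw [← sub_eq_zero, pow_succ, Module.End.mul_apply, ← map_sub, ← map_sub]
      exact hQ _ (S.derivEnd_pow_mem hstab _ _ (hfrob (S.derivEnd_comm_mem _ _ p)))
    have hlin : S.derivEnd v (S.derivEnd (x + t • v) p) =
        S.derivEnd v (S.derivEnd x p) + t • S.derivEnd v (S.derivEnd v p) := by
      rw [map_add, map_smul, LinearMap.add_apply, LinearMap.smul_apply, map_add, map_smul]
    rw [hlin] at hcomm
    rw [map_add _ (S.derivEnd v (S.derivEnd x p)), map_smul, map_add, smul_eval] at hcomm
    simp only [id, one_mul]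
    rw [← hcomm]
    push_cast
    ring

theorem fderiv_lieSeries {P : Ideal (MvPolynomial (Fin n) ℂ)} {Q : Fin n → ℂ}
    (hQ : ∀ p ∈ P, eval Q p = 0) (hstab : ∀ j, ∀ p ∈ P, S.totalDeriv j p ∈ P)
    (hfrob : S.frobeniusIdeal ≤ P) {U : Set (Fin m → ℂ)} (hU : IsOpen U)
    {p : MvPolynomial (Fin n) ℂ} {u : ℕ → ℝ} (hu : Summable u)
    (hle : ∀ x ∈ U, ∀ k, ‖S.lieTerm Q k x p‖ ≤ u k)
    (hd : AnalyticOnNhd ℂ (fun x => S.lieSeries Q x p) U) {x : Fin m → ℂ} (hx : x ∈ U)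
    (v : Fin m → ℂ) :
    fderiv ℂ (fun x => S.lieSeries Q x p) x v = S.lieSeries Q x (S.derivEnd v p) := by
  have hline (t : ℂ) : HasDerivAt (fun t : ℂ => x + t • v) v t := by
    simpa using ((hasDerivAt_id t).smul_const v).const_add x
  have hcont : Continuous fun t : ℂ => x + t • v := by fun_prop
  have hterm (k : ℕ) (t : ℂ) : HasDerivAt (fun t : ℂ => S.lieTerm Q (k + 1) (x + t • v) p)
      (S.lieTerm Q k (x + t • v) (S.derivEnd v p)) t := by
    refine ((S.hasDerivAt_eval_derivEnd_pow hQ hstab hfrob x v k p t).const_mul _).congr_deriv ?_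
    have h1 : (k.factorial : ℂ) ≠ 0 := by exact_mod_cast Nat.factorial_ne_zero _
    have h2 : ((k + 1 : ℕ) : ℂ) ≠ 0 := by exact_mod_cast k.succ_ne_zero
    rw [lieTerm, Nat.factorial_succ, Nat.cast_mul]
    field_simp
  have hterm0 (t : ℂ) : HasDerivAt (fun t : ℂ => S.lieTerm Q 0 (x + t • v) p) 0 t := by
    simpa [lieTerm] using hasDerivAt_const t (eval Q p)
  have hsum := Complex.hasSum_deriv_of_summable_norm
    (F := fun k t => S.lieTerm Q k (x + t • v) p) (U := (fun t : ℂ => x + t • v) ⁻¹' U) hu ?_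
    (hU.preimage hcont) (fun k t ht => hle _ ht k) (z := 0) (by simpa using hx)
  · have hx0 : x + (0 : ℂ) • v ∈ U := by simpa using hx
    have hcomp := (hd _ hx0).differentiableAt.hasFDerivAt.comp_hasDerivAt 0 (hline 0)
    have hderiv : deriv (fun t : ℂ => ∑' k, S.lieTerm Q k (x + t • v) p) 0 =
        fderiv ℂ (fun x => S.lieSeries Q x p) x v := by
      have := hcomp.deriv
      rw [zero_smul, add_zero] at this
      exact this
    rw [hderiv, ← hasSum_nat_add_iff' 1] at hsum
    simp only [(hterm _ _).deriv, Finset.range_one, Finset.sum_singleton, (hterm0 _).deriv,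
      sub_zero, zero_smul, add_zero] at hsum
    exact hsum.tsum_eq.symm
  · intro k t _
    cases k with
    | zero => exact (hterm0 t).differentiableAt.differentiableWithinAt
    | succ k => exact (hterm k t).differentiableAt.differentiableWithinAt

/-- If the system is stable and satisfies the Frobenius conditions modulo an ideal `P` of
polynomials vanishing at `Q`, then it has a local solution through `Q` inside the zeros of `P`. -/
theorem exists_solution_of_stable_ideal {P : Ideal (MvPolynomial (Fin n) ℂ)} {Q : Fin n → ℂ}
    (hQ : ∀ p ∈ P, eval Q p = 0) (hstab : ∀ j, ∀ p ∈ P, S.totalDeriv j p ∈ P)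
    (hfrob : S.frobeniusIdeal ≤ P) (hg : ∀ k, S.g k ∈ P) :
    ∃ (U : Set (Fin m → ℂ)) (γ : (Fin m → ℂ) → (Fin n → ℂ)),
      S.IsSolution U γ ∧ Q ∈ γ '' U ∧ ∀ x ∈ U, ∀ p ∈ P, eval (γ x) p = 0 := by
  obtain ⟨r, hr, h⟩ := S.exists_lieSeries_convergence Q
  choose h han using h
  choose M hM using h
  have hgeo (p) : Summable fun k : ℕ => M p * (1 / 2 : ℝ) ^ k :=
    (summable_geometric_of_lt_one (by norm_num) (by norm_num)).mul_left _
  have hsum : ∀ x ∈ Metric.ball (0 : Fin m → ℂ) r, ∀ p,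
      Summable fun k => ‖S.lieTerm Q k x p‖ := fun x hx p =>
    (hgeo p).of_nonneg_of_le (fun _ => norm_nonneg _) (hM p x hx)
  have hvan : ∀ x ∈ Metric.ball (0 : Fin m → ℂ) r, ∀ p ∈ P,
      eval (fun i => S.lieSeries Q x (X i)) p = 0 := fun x hx p hp => by
    rw [← lieSeries_eq_eval (hsum x hx), lieSeries]
    simp [lieTerm, hQ _ (S.derivEnd_pow_mem hstab x _ hp)]
  refine ⟨Metric.ball 0 r, fun x i => S.lieSeries Q x (X i),
    ⟨Metric.isOpen_ball, ⟨0, Metric.mem_ball_self hr⟩, AnalyticOnNhd.pi fun i => han (X i), ?_,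
      fun x hx k => hvan x hx _ (hg k)⟩, ⟨0, Metric.mem_ball_self hr, ?_⟩, hvan⟩
  · intro x hx i j
    rw [fderiv_pi fun i => (han (X i) x hx).differentiableAt]
    have := S.fderiv_lieSeries hQ hstab hfrob Metric.isOpen_ball (hgeo (X i)) (hM (X i))
      (han (X i)) hx (Pi.single j 1)
    rw [derivEnd_single, totalDeriv_X, lieSeries_eq_eval (hsum x hx)] at this
    exact this
  · ext i
    simp [lieSeries_zero]

end PfaffianSystem

namespace MvPolynomial

theorem IsHomogeneous.eval_smul {σ R : Type*} [Fintype σ] [CommSemiring R] {P : MvPolynomial σ R}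
    {k : ℕ} (hP : P.IsHomogeneous k) (c : R) (x : σ → R) :
    eval (c • x) P = c ^ k * eval x P := by
  rw [eval_eq', eval_eq', Finset.mul_sum]
  refine Finset.sum_congr rfl fun d hd => ?_
  have hdeg : ∑ i, d i = k := by
    rw [← hP (mem_support_iff.1 hd)]
    simp [Finsupp.weight_apply, Finsupp.sum_fintype]
  simp only [Pi.smul_apply, smul_eq_mul, mul_pow, Finset.prod_mul_distrib]
  rw [Finset.prod_pow_eq_pow_sum, hdeg]
  ring

/-- A homogeneous polynomial that vanishes at the origin to an order beyond its degree is zero. -/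
theorem IsHomogeneous.eq_zero_of_isBigO {σ : Type*} [Fintype σ] {P : MvPolynomial σ ℂ} {k : ℕ}
    (hP : P.IsHomogeneous k)
    (hO : (fun x : σ → ℂ => eval x P) =O[𝓝 0] fun x => ‖x‖ ^ (k + 1)) : P = 0 := by
  refine MvPolynomial.funext fun x => ?_
  rw [map_zero]
  obtain ⟨c, hc⟩ := hO.bound
  have hlim : Filter.Tendsto (fun ε : ℝ => (ε : ℂ) • x) (𝓝[>] 0) (𝓝 0) := by
    have h : Continuous fun ε : ℝ => (ε : ℂ) • x := by fun_prop
    simpa using (h.tendsto 0).mono_left nhdsWithin_le_nhds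
  have hle : ∀ᶠ ε : ℝ in 𝓝[>] 0, ‖eval x P‖ ≤ c * (ε * ‖x‖ ^ (k + 1)) := by
    filter_upwards [hlim.eventually hc, self_mem_nhdsWithin] with ε hε hpos
    have hpos : 0 < ε := hpos
    rw [hP.eval_smul, norm_mul, norm_pow, norm_pow, norm_norm, norm_smul, Complex.norm_real,
      Real.norm_of_nonneg hpos.le, mul_pow, pow_succ ε] at hε
    refine le_of_mul_le_mul_left (hε.trans_eq ?_) (pow_pos hpos k)
    ring
  have hlim' : Filter.Tendsto (fun ε : ℝ => c * (ε * ‖x‖ ^ (k + 1))) (𝓝[>] 0) (𝓝 0) := by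
    have h : Continuous fun ε : ℝ => c * (ε * ‖x‖ ^ (k + 1)) := by fun_prop
    simpa using (h.tendsto 0).mono_left nhdsWithin_le_nhds
  exact norm_le_zero_iff.1 (ge_of_tendsto hlim' hle)

variable {n : ℕ} {Q : Fin n → ℂ}

theorem mem_vanishingIdeal_point {p : MvPolynomial (Fin n) ℂ} :
    p ∈ vanishingIdeal ℂ {Q} ↔ eval Q p = 0 := by
  simp

/-- The ideal of the polynomials that belong to `I` after multiplication by a polynomial not
vanishing at `Q`: the contraction of the extension of `I` to the local ring at `Q`. -/
def localContraction (I : Ideal (MvPolynomial (Fin n) ℂ)) (Q : Fin n → ℂ) :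
    Ideal (MvPolynomial (Fin n) ℂ) where
  carrier := {p | ∃ u, eval Q u ≠ 0 ∧ u * p ∈ I}
  zero_mem' := ⟨1, by simp, by simp⟩
  add_mem' := by
    rintro p q ⟨u, hu, hup⟩ ⟨v, hv, hvq⟩
    refine ⟨u * v, by simp [hu, hv], ?_⟩
    have : u * v * (p + q) = v * (u * p) + u * (v * q) := by ring
    rw [this]
    exact add_mem (I.mul_mem_left _ hup) (I.mul_mem_left _ hvq)
  smul_mem' := by
    rintro a p ⟨u, hu, hup⟩
    refine ⟨u, hu, ?_⟩
    rw [smul_eq_mul, mul_left_comm]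
    exact I.mul_mem_left _ hup

theorem mem_localContraction {I : Ideal (MvPolynomial (Fin n) ℂ)} {p : MvPolynomial (Fin n) ℂ} :
    p ∈ localContraction I Q ↔ ∃ u, eval Q u ≠ 0 ∧ u * p ∈ I := Iff.rfl

theorem le_localContraction (I : Ideal (MvPolynomial (Fin n) ℂ)) : I ≤ localContraction I Q :=
  fun p hp => ⟨1, by simp, by simpa⟩

theorem localContraction_mono {I J : Ideal (MvPolynomial (Fin n) ℂ)} (h : I ≤ J) :
    localContraction I Q ≤ localContraction J Q :=
  fun _ ⟨u, hu, hup⟩ => ⟨u, hu, h hup⟩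

theorem localContraction_le_vanishingIdeal {I : Ideal (MvPolynomial (Fin n) ℂ)}
    (hI : I ≤ vanishingIdeal ℂ {Q}) : localContraction I Q ≤ vanishingIdeal ℂ {Q} := by
  rintro p ⟨u, hu, hup⟩
  have h := mem_vanishingIdeal_point.1 (hI hup)
  rw [map_mul, mul_eq_zero] at h
  exact mem_vanishingIdeal_point.2 (h.resolve_left hu)

/-- A polynomial is determined modulo the square of the maximal ideal by its value and gradient. -/
theorem sub_linear_mem_sq (Q : Fin n → ℂ) (p : MvPolynomial (Fin n) ℂ) :
    p - (C (eval Q p) + ∑ i, C (gradientAt Q p i) * (X i - C (Q i))) ∈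
      vanishingIdeal ℂ {Q} ^ 2 := by
  induction p using MvPolynomial.induction_on with
  | C a => simp [gradientAt_apply]
  | add p q hp hq =>
    convert add_mem hp hq using 1
    simp only [map_add, Pi.add_apply, add_mul, Finset.sum_add_distrib]
    ring
  | mul_X p i hp =>
    have hX : X i - C (Q i) ∈ vanishingIdeal ℂ {Q} := mem_vanishingIdeal_point.2 (by simp)
    have hp0 : p - C (eval Q p) ∈ vanishingIdeal ℂ {Q} := mem_vanishingIdeal_point.2 (by simp)
    convert add_mem (Ideal.mul_mem_left _ (C (Q i)) hp)
      ((pow_two (vanishingIdeal ℂ {Q})).symm ▸ Ideal.mul_mem_mul hp0 hX) using 1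
    have hs : ∑ j, C (gradientAt Q (p * X i) j) * (X j - C (Q j)) =
        C (Q i) * ∑ j, C (gradientAt Q p j) * (X j - C (Q j)) +
          C (eval Q p) * (X i - C (Q i)) := by
      have hg (j : Fin n) : gradientAt Q (p * X i) j =
          Q i * gradientAt Q p j + if j = i then eval Q p else 0 := by
        rw [gradientAt_mul]
        simp [gradientAt_apply, pderiv_X, Pi.single_apply, eq_comm, add_comm,
          apply_ite (eval Q)]
      simp only [hg, map_add, map_mul, add_mul, Finset.sum_add_distrib, Finset.mul_sum, mul_assoc]
      congr 1
      rw [Finset.sum_eq_single i]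
      · simp
      · intro j _ hj; simp [hj]
      · simp
    rw [hs]
    simp only [map_mul, eval_X]
    ring

theorem mem_sq_of_gradientAt_eq_zero {p : MvPolynomial (Fin n) ℂ} (h0 : eval Q p = 0)
    (h1 : gradientAt Q p = 0) : p ∈ vanishingIdeal ℂ {Q} ^ 2 := by
  simpa [h0, h1] using sub_linear_mem_sq Q p

/-- Polynomials `h`, `t` that form a system of local coordinates at `Q`. -/
structure IsLocalFrame {r d : ℕ} (Q : Fin n → ℂ) (h : Fin r → MvPolynomial (Fin n) ℂ)
    (t : Fin d → MvPolynomial (Fin n) ℂ) : Prop where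
  eval_h : ∀ i, eval Q (h i) = 0
  eval_t : ∀ j, eval Q (t j) = 0
  card_eq : r + d = n
  span_eq_top : Submodule.span ℂ (Set.range fun k => gradientAt Q (Sum.elim h t k)) = ⊤

namespace IsLocalFrame

variable {r d : ℕ} {h : Fin r → MvPolynomial (Fin n) ℂ} {t : Fin d → MvPolynomial (Fin n) ℂ}

theorem span_h_le (F : IsLocalFrame Q h t) : Ideal.span (Set.range h) ≤ vanishingIdeal ℂ {Q} :=
  Ideal.span_le.2 <| by rintro _ ⟨i, rfl⟩; exact mem_vanishingIdeal_point.2 (F.eval_h i)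

/-- A linear combination of the frame approximates an element of the maximal ideal. -/
theorem exists_linear (F : IsLocalFrame Q h t) {p : MvPolynomial (Fin n) ℂ}
    (hp : p ∈ vanishingIdeal ℂ {Q}) :
    ∃ (a : Fin r → ℂ) (b : Fin d → ℂ),
      p - (∑ i, C (a i) * h i + ∑ j, C (b j) * t j) ∈ vanishingIdeal ℂ {Q} ^ 2 := by
  have hmem : gradientAt Q p ∈
      Submodule.span ℂ (Set.range fun k => gradientAt Q (Sum.elim h t k)) := by
    rw [F.span_eq_top]; trivial
  obtain ⟨c, hc⟩ := (Submodule.mem_span_range_iff_exists_fun ℂ).1 hmem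
  rw [Fintype.sum_sum_type] at hc
  simp only [Sum.elim_inl, Sum.elim_inr] at hc
  refine ⟨fun i => c (.inl i), fun j => c (.inr j), mem_sq_of_gradientAt_eq_zero ?_ ?_⟩
  · simp [mem_vanishingIdeal_point.1 hp, F.eval_h, F.eval_t]
  · simp only [← smul_eq_C_mul, map_sub, map_add, map_sum, map_smul]
    rw [hc, sub_self]

/-- Near `Q` the common zeros of `h` are parametrized by the coordinates `t`. -/
theorem exists_parametrization (F : IsLocalFrame Q h t) :
    ∃ ψ : (Fin d → ℂ) → (Fin n → ℂ),
      Filter.Tendsto ψ (𝓝 0) (𝓝 Q) ∧ (fun x => ψ x - Q) =O[𝓝 0] (fun x => x) ∧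
      ∀ᶠ x in 𝓝 0, (∀ i, eval (ψ x) (h i) = 0) ∧ ∀ j, eval (ψ x) (t j) = x j := by
  let D (k : Fin r ⊕ Fin d) : (Fin n → ℂ) →L[ℂ] ℂ :=
    ∑ i, gradientAt Q (Sum.elim h t k) i • (ContinuousLinearMap.proj i : (Fin n → ℂ) →L[ℂ] ℂ)
  have hinj : Function.Injective (ContinuousLinearMap.pi D).toLinearMap := by
    rw [← LinearMap.ker_eq_bot, LinearMap.ker_eq_bot']
    intro v hv
    have hall : ∀ w : Fin n → ℂ, ∑ i, w i * v i = 0 := fun w => by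
      have hw : w ∈ Submodule.span ℂ (Set.range fun k => gradientAt Q (Sum.elim h t k)) := by
        rw [F.span_eq_top]; trivial
      induction hw using Submodule.span_induction with
      | mem w hw =>
        obtain ⟨k, rfl⟩ := hw
        simpa [D] using congrFun hv k
      | zero => simp
      | add w w' _ _ h1 h2 => simp [add_mul, Finset.sum_add_distrib, h1, h2]
      | smul c w _ h1 => simp [mul_assoc, ← Finset.mul_sum, h1]
    ext i
    simpa [Pi.single_apply] using hall (Pi.single i 1)
  let e : (Fin n → ℂ) ≃L[ℂ] (Fin r ⊕ Fin d → ℂ) :=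
    (LinearMap.linearEquivOfInjective (ContinuousLinearMap.pi D).toLinearMap hinj
      (by simp [F.card_eq])).toContinuousLinearEquiv
  have he : HasStrictFDerivAt (fun (z : Fin n → ℂ) k => eval z (Sum.elim h t k))
      (e : (Fin n → ℂ) →L[ℂ] (Fin r ⊕ Fin d → ℂ)) Q := by
    have : (e : (Fin n → ℂ) →L[ℂ] (Fin r ⊕ Fin d → ℂ)) = ContinuousLinearMap.pi D := by
      ext v k; rfl
    rw [this]
    exact hasStrictFDerivAt_pi.2 fun k => hasStrictFDerivAt_eval _ Q
  have h0 : (fun k => eval Q (Sum.elim h t k)) = 0 := by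
    ext k
    cases k with
    | inl i => exact F.eval_h i
    | inr j => exact F.eval_t j
  let ι : (Fin d → ℂ) →L[ℂ] (Fin r ⊕ Fin d → ℂ) :=
    ContinuousLinearMap.pi (Sum.elim 0 fun j => ContinuousLinearMap.proj j)
  have hg := he.to_localInverse
  have hgQ : he.localInverse _ _ _ 0 = Q := by
    rw [← h0]; exact he.localInverse_apply_image
  have hright := he.eventually_right_inverse
  rw [h0] at hg hright
  have hgι : HasFDerivAt (fun x => he.localInverse _ _ _ (ι x)) _ 0 :=
    HasFDerivAt.comp (x := (0 : Fin d → ℂ)) (f := ι) (f' := ι) (by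
      rw [map_zero]; exact hg.hasFDerivAt) ι.hasFDerivAt
  have hι : Filter.Tendsto ι (𝓝 0) (𝓝 0) := by
    simpa using ι.continuous.tendsto 0
  refine ⟨fun x => he.localInverse _ _ _ (ι x), ?_, ?_, ?_⟩
  · have := hgι.continuousAt.tendsto
    simpa only [map_zero, hgQ] using this
  · have := hgι.isBigO_sub
    simpa only [map_zero, hgQ, sub_zero] using this
  · filter_upwards [hι.eventually hright] with x hx
    exact ⟨fun i => congrFun hx (.inl i), fun j => congrFun hx (.inr j)⟩

end IsLocalFrame

end MvPolynomial

namespace Ideal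

theorem sup_mul_sup_le_sup_mul {R : Type*} [CommSemiring R] (I J K : Ideal R) :
    (I ⊔ J) * (I ⊔ K) ≤ I ⊔ J * K := by
  rw [sup_mul, mul_sup J]
  exact sup_le ((mul_le_inf.trans inf_le_left).trans le_sup_left)
    (sup_le ((mul_le_inf.trans inf_le_right).trans le_sup_left) le_sup_right)

/-- Krull's intersection theorem modulo an ideal. -/
theorem exists_sub_one_mem_mul_mem {R : Type*} [CommRing R] [IsNoetherianRing R] {I J : Ideal R}
    {p : R} (hp : ∀ k, p ∈ I ⊔ J ^ k) : ∃ a ∈ J, (1 - a) * p ∈ I := by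
  have hmem : Quotient.mk I p ∈ (⨅ k : ℕ, J ^ k • ⊤ : Submodule R (R ⧸ I)) := by
    rw [Submodule.mem_iInf]
    intro k
    obtain ⟨a, ha, b, hb, rfl⟩ := Submodule.mem_sup.1 (hp k)
    have : Quotient.mk I (a + b) = b • (1 : R ⧸ I) := by
      rw [map_add, Quotient.eq_zero_iff_mem.2 ha, zero_add, Algebra.smul_def, mul_one]; rfl
    rw [this]
    exact Submodule.smul_mem_smul hb trivial
  obtain ⟨⟨a, ha⟩, h⟩ := (mem_iInf_smul_pow_eq_bot_iff J _).1 hmem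
  refine ⟨a, ha, Quotient.eq_zero_iff_mem.1 ?_⟩
  rw [Algebra.smul_def] at h
  rw [map_mul, map_sub, map_one, sub_mul, one_mul]
  exact sub_eq_zero.2 h.symm

end Ideal

namespace MvPolynomial

variable {n : ℕ} {Q : Fin n → ℂ}

theorem isBigO_eval_comp_of_mem_pow {d : ℕ} {ψ : (Fin d → ℂ) → (Fin n → ℂ)}
    (hψ : Filter.Tendsto ψ (𝓝 0) (𝓝 Q)) (hO : (fun x => ψ x - Q) =O[𝓝 0] (fun x => x)) (k : ℕ)
    {p : MvPolynomial (Fin n) ℂ} (hp : p ∈ vanishingIdeal ℂ {Q} ^ k) :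
    (fun x => eval (ψ x) p) =O[𝓝 0] fun x => ‖x‖ ^ k := by
  induction k generalizing p with
  | zero =>
    simpa using ((continuous_eval_left p).continuousAt.tendsto.comp hψ).isBigO_one ℝ
  | succ k ih =>
    rw [pow_succ] at hp
    refine Submodule.mul_induction_on hp (fun a ha b hb => ?_) fun a b ha hb => ?_
    · have h1 := ((hasStrictFDerivAt_eval b Q).hasFDerivAt.isBigO_sub.comp_tendsto hψ).trans hO
      simp only [Function.comp_def, mem_vanishingIdeal_point.1 hb, sub_zero] at h1
      simpa [pow_succ] using (ih ha).mul h1.norm_right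
    · simpa using ha.add hb

namespace IsLocalFrame

variable {r d : ℕ} {h : Fin r → MvPolynomial (Fin n) ℂ} {t : Fin d → MvPolynomial (Fin n) ℂ}

theorem exists_leadingForm_of_mem_pow (F : IsLocalFrame Q h t) (k : ℕ)
    {p : MvPolynomial (Fin n) ℂ} (hp : p ∈ vanishingIdeal ℂ {Q} ^ k) :
    ∃ P : MvPolynomial (Fin d) ℂ, P.IsHomogeneous k ∧
      p - aeval t P ∈ Ideal.span (Set.range h) ⊔ vanishingIdeal ℂ {Q} ^ (k + 1) := by
  set H := Ideal.span (Set.range h)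
  set m := vanishingIdeal ℂ {Q}
  induction k generalizing p with
  | zero =>
    refine ⟨C (eval Q p), isHomogeneous_C _ _, Ideal.mem_sup_right ?_⟩
    rw [zero_add, pow_one]
    exact mem_vanishingIdeal_point.2 (by simp [algebraMap_eq])
  | succ k ih =>
    rw [pow_succ] at hp
    refine Submodule.mul_induction_on hp (fun a ha b hb => ?_) fun a b => ?_
    · obtain ⟨A, hA, hAa⟩ := ih ha
      obtain ⟨c, e, hce⟩ := F.exists_linear hb
      have hB : b - aeval t (∑ j, C (e j) * X j : MvPolynomial (Fin d) ℂ) ∈ H ⊔ m ^ 2 := by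
        have hc : ∑ i, C (c i) * h i ∈ H :=
          sum_mem fun i _ => H.mul_mem_left _ (Ideal.subset_span ⟨i, rfl⟩)
        convert add_mem (Ideal.mem_sup_left hc) (Ideal.mem_sup_right hce : _ ∈ H ⊔ m ^ 2) using 1
        simp only [map_sum, map_mul, aeval_X, aeval_C, algebraMap_eq]
        ring
      have hB1 : aeval t (∑ j, C (e j) * X j : MvPolynomial (Fin d) ℂ) ∈ H ⊔ m := by
        have := sub_mem (Ideal.mem_sup_right hb : b ∈ H ⊔ m)
          (sup_le_sup_left (Ideal.pow_le_self two_ne_zero) H hB)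
        rwa [sub_sub_cancel] at this
      refine ⟨A * ∑ j, C (e j) * X j, hA.mul (IsHomogeneous.sum _ _ _ fun j _ => by
        simpa using (isHomogeneous_C _ (e j)).mul (isHomogeneous_X ℂ j)), ?_⟩
      have h1 := Ideal.sup_mul_sup_le_sup_mul H _ _
        (Ideal.mul_mem_mul (Ideal.mem_sup_right ha : a ∈ H ⊔ m ^ k) hB)
      have h2 := Ideal.sup_mul_sup_le_sup_mul H _ _ (Ideal.mul_mem_mul hAa hB1)
      rw [← pow_add] at h1
      rw [← pow_succ] at h2
      convert add_mem h1 h2 using 1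
      rw [map_mul]
      ring
    · rintro ⟨A, hA, hAa⟩ ⟨B, hB, hBb⟩
      refine ⟨A + B, hA.add hB, ?_⟩
      rw [map_add, add_sub_add_comm]
      exact add_mem hAa hBb

/-- Every element of order at least `k` modulo `h` has a leading form in the coordinates `t`. -/
theorem exists_leadingForm (F : IsLocalFrame Q h t) (k : ℕ) {p : MvPolynomial (Fin n) ℂ}
    (hp : p ∈ Ideal.span (Set.range h) ⊔ vanishingIdeal ℂ {Q} ^ k) :
    ∃ P : MvPolynomial (Fin d) ℂ, P.IsHomogeneous k ∧
      p - aeval t P ∈ Ideal.span (Set.range h) ⊔ vanishingIdeal ℂ {Q} ^ (k + 1) := by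
  obtain ⟨a, ha, b, hb, rfl⟩ := Submodule.mem_sup.1 hp
  obtain ⟨P, hP, hmem⟩ := F.exists_leadingForm_of_mem_pow k hb
  refine ⟨P, hP, ?_⟩
  rw [add_sub_assoc]
  exact add_mem (Ideal.mem_sup_left ha) hmem

theorem eval_eq_zero_of_mem_span {p : MvPolynomial (Fin n) ℂ} (hp : p ∈ Ideal.span (Set.range h))
    {z : Fin n → ℂ} (hz : ∀ i, eval z (h i) = 0) : eval z p = 0 := by
  have : Ideal.span (Set.range h) ≤ RingHom.ker (eval z) :=
    Ideal.span_le.2 (by rintro _ ⟨i, rfl⟩; exact hz i)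
  exact this hp

section Parametrization

variable {ψ : (Fin d → ℂ) → (Fin n → ℂ)}

theorem leadingForm_eq_zero (hψ : Filter.Tendsto ψ (𝓝 0) (𝓝 Q))
    (hO : (fun x => ψ x - Q) =O[𝓝 0] (fun x => x))
    (hψt : ∀ᶠ x in 𝓝 0, (∀ i, eval (ψ x) (h i) = 0) ∧ ∀ j, eval (ψ x) (t j) = x j)
    {k : ℕ} {P : MvPolynomial (Fin d) ℂ} (hP : P.IsHomogeneous k) {p : MvPolynomial (Fin n) ℂ}
    (hmem : p - aeval t P ∈ Ideal.span (Set.range h) ⊔ vanishingIdeal ℂ {Q} ^ (k + 1))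
    (hp : ∀ᶠ x in 𝓝 0, eval (ψ x) p = 0) : P = 0 := by
  refine hP.eq_zero_of_isBigO ?_
  obtain ⟨a, ha, b, hb, hab⟩ := Submodule.mem_sup.1 hmem
  refine (isBigO_eval_comp_of_mem_pow hψ hO (k + 1) hb).neg_left.congr' ?_ Filter.EventuallyEq.rfl
  filter_upwards [hψt, hp] with x hx hpx
  have h1 := congrArg (eval (ψ x)) hab
  have h2 : eval (ψ x) (aeval t P) = eval x P := by
    clear * - hx
    induction P using MvPolynomial.induction_on with
    | C a => simp [algebraMap_eq]
    | add P P' h1 h2 => rw [map_add, map_add, map_add, h1, h2]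
    | mul_X P j h1 => rw [map_mul, map_mul, map_mul, h1, aeval_X, eval_X, hx.2]
  rw [map_add, map_sub, hpx, h2, eval_eq_zero_of_mem_span ha hx.1] at h1
  linear_combination -h1

/-- The polynomials vanishing on the parametrized germ lie in `(h)` locally. -/
theorem mem_localContraction_of_eventually (F : IsLocalFrame Q h t)
    (hψ : Filter.Tendsto ψ (𝓝 0) (𝓝 Q)) (hO : (fun x => ψ x - Q) =O[𝓝 0] (fun x => x))
    (hψt : ∀ᶠ x in 𝓝 0, (∀ i, eval (ψ x) (h i) = 0) ∧ ∀ j, eval (ψ x) (t j) = x j)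
    {p : MvPolynomial (Fin n) ℂ} (hp : ∀ᶠ x in 𝓝 0, eval (ψ x) p = 0) :
    p ∈ localContraction (Ideal.span (Set.range h)) Q := by
  obtain ⟨a, ha, hap⟩ := Ideal.exists_sub_one_mem_mul_mem (I := Ideal.span (Set.range h))
    (J := vanishingIdeal ℂ {Q}) (p := p) fun k => by
      induction k with
      | zero => simp
      | succ k ih =>
        obtain ⟨P, hP, hmem⟩ := F.exists_leadingForm k ih
        simpa [leadingForm_eq_zero hψ hO hψt hP hmem hp] using hmem
  exact ⟨1 - a, by simp [mem_vanishingIdeal_point.1 ha], hap⟩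

theorem eventually_eq_zero_of_mem_localContraction (hψ : Filter.Tendsto ψ (𝓝 0) (𝓝 Q))
    (hψh : ∀ᶠ x in 𝓝 0, ∀ i, eval (ψ x) (h i) = 0) {p : MvPolynomial (Fin n) ℂ}
    (hp : p ∈ localContraction (Ideal.span (Set.range h)) Q) :
    ∀ᶠ x in 𝓝 0, eval (ψ x) p = 0 := by
  obtain ⟨u, hu, hup⟩ := hp
  have hu' : ∀ᶠ x in 𝓝 0, eval (ψ x) u ≠ 0 :=
    ((continuous_eval_left u).continuousAt.tendsto.comp hψ).eventually_ne hu
  filter_upwards [hψh, hu'] with x hx hux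
  have := eval_eq_zero_of_mem_span hup hx
  rw [map_mul, mul_eq_zero] at this
  exact this.resolve_left hux

end Parametrization

/-- The germ defined by the frame functions `h` is irreducible. -/
theorem isPrime_localContraction (F : IsLocalFrame Q h t) :
    (localContraction (Ideal.span (Set.range h)) Q).IsPrime := by
  obtain ⟨ψ, hψ, hO, hψt⟩ := F.exists_parametrization
  set H := Ideal.span (Set.range h)
  set m := vanishingIdeal ℂ {Q}
  have hlead {p : MvPolynomial (Fin n) ℂ} (hp : p ∉ localContraction H Q) :
      ∃ (k : ℕ) (P : MvPolynomial (Fin d) ℂ), P.IsHomogeneous k ∧ P ≠ 0 ∧ p ∈ H ⊔ m ^ k ∧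
        p - aeval t P ∈ H ⊔ m ^ (k + 1) := by
    by_contra! hcon
    refine hp ?_
    obtain ⟨a, ha, hap⟩ := Ideal.exists_sub_one_mem_mul_mem (I := H) (J := m) (p := p) fun k => by
      induction k with
      | zero => simp
      | succ k ih =>
        obtain ⟨P, hP, hmem⟩ := F.exists_leadingForm k ih
        by_cases hP0 : P = 0
        · simpa [hP0] using hmem
        · exact absurd hmem (hcon k P hP hP0 ih)
    exact ⟨1 - a, by simp [mem_vanishingIdeal_point.1 ha], hap⟩
  refine ⟨fun htop => ?_, fun {p q} hpq => ?_⟩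
  · have := localContraction_le_vanishingIdeal F.span_h_le (htop ▸ Submodule.mem_top :
      (1 : MvPolynomial (Fin n) ℂ) ∈ _)
    simpa using mem_vanishingIdeal_point.1 this
  · by_contra! hcon
    obtain ⟨k, P, hP, hP0, hpk, hpP⟩ := hlead hcon.1
    obtain ⟨l, P', hP', hP'0, hql, hqP'⟩ := hlead hcon.2
    refine mul_ne_zero hP0 hP'0 (leadingForm_eq_zero (p := p * q) hψ hO hψt (hP.mul hP') ?_
      (eventually_eq_zero_of_mem_localContraction hψ (hψt.mono fun _ hx => hx.1) hpq))
    have hP1 : aeval t P' ∈ H ⊔ m ^ l := by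
      have := sub_mem hql (sup_le_sup_left (Ideal.pow_le_pow_right l.le_succ) H hqP')
      rwa [sub_sub_cancel] at this
    have h1 := Ideal.sup_mul_sup_le_sup_mul H _ _ (Ideal.mul_mem_mul hpk hqP')
    have h2 := Ideal.sup_mul_sup_le_sup_mul H _ _ (Ideal.mul_mem_mul hpP hP1)
    rw [← pow_add, ← add_assoc] at h1
    rw [← pow_add, add_right_comm] at h2
    convert add_mem h1 h2 using 1
    rw [map_mul]
    ring

end IsLocalFrame

end MvPolynomial

namespace MvPolynomial

variable {n : ℕ} {Q : Fin n → ℂ}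

/-- The polynomials vanishing at `Q` with gradient in `G`. -/
def gradientIdeal (Q : Fin n → ℂ) (G : Submodule ℂ (Fin n → ℂ)) :
    Ideal (MvPolynomial (Fin n) ℂ) where
  carrier := {p | eval Q p = 0 ∧ gradientAt Q p ∈ G}
  zero_mem' := by simp
  add_mem' := by
    rintro p q ⟨hp, hp'⟩ ⟨hq, hq'⟩
    exact ⟨by rw [map_add, hp, hq, add_zero], by rw [map_add]; exact add_mem hp' hq'⟩
  smul_mem' := by
    rintro a p ⟨hp, hp'⟩
    refine ⟨by rw [smul_eq_mul, map_mul, hp, mul_zero], ?_⟩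
    rw [smul_eq_mul, gradientAt_mul, hp, zero_smul, add_zero]
    exact G.smul_mem _ hp'

/-- The space of the gradients at `Q` of the elements of `I`. -/
noncomputable def gradientSpace (I : Ideal (MvPolynomial (Fin n) ℂ)) (Q : Fin n → ℂ) :
    Submodule ℂ (Fin n → ℂ) :=
  (I.restrictScalars ℂ).map (gradientAt Q)

theorem mem_primeCompl_vanishingIdeal {u : MvPolynomial (Fin n) ℂ} :
    u ∈ (vanishingIdeal ℂ {Q} : Ideal (MvPolynomial (Fin n) ℂ)).primeCompl ↔ eval Q u ≠ 0 :=
  not_congr mem_vanishingIdeal_point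

/-- Near a point there is a local frame whose first part lies in a given ideal and has
the maximal possible length. -/
theorem exists_isLocalFrame {I : Ideal (MvPolynomial (Fin n) ℂ)} (hI : I ≤ vanishingIdeal ℂ {Q}) :
    ∃ (d : ℕ) (h : Fin (Module.finrank ℂ (gradientSpace I Q)) → MvPolynomial (Fin n) ℂ)
      (t : Fin d → MvPolynomial (Fin n) ℂ), IsLocalFrame Q h t ∧ ∀ i, h i ∈ I := by
  set T := gradientSpace I Q
  obtain ⟨T', hT'⟩ := Submodule.exists_isCompl T
  let b := Module.finBasis ℂ T
  let b' := Module.finBasis ℂ T'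
  have hb (i) : ∃ p ∈ I, gradientAt Q p = b i := by
    obtain ⟨p, hp, hpb⟩ := (b i).2
    exact ⟨p, hp, hpb⟩
  choose h hh hhb using hb
  let t (j) : MvPolynomial (Fin n) ℂ := ∑ i, C ((b' j : Fin n → ℂ) i) * (X i - C (Q i))
  have ht (j) : gradientAt Q (t j) = b' j := by
    ext i
    simp [t, ← smul_eq_C_mul, gradientAt_apply, pderiv_X, Pi.single_apply, smul_eval]
  refine ⟨_, h, t, ⟨fun i => mem_vanishingIdeal_point.1 (hI (hh i)), fun j => by simp [t], ?_, ?_⟩,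
    hh⟩
  · simpa using Submodule.finrank_add_eq_of_isCompl hT'
  · have hr : (fun k => gradientAt Q (Sum.elim h t k)) =
        Sum.elim (fun i => (b i : Fin n → ℂ)) fun j => (b' j : Fin n → ℂ) := by
      ext k : 1
      cases k with
      | inl i => exact hhb i
      | inr j => exact ht j
    have hspan {T : Submodule ℂ (Fin n → ℂ)} {r : ℕ} (b : Module.Basis (Fin r) ℂ T) :
        Submodule.span ℂ (Set.range fun i => (b i : Fin n → ℂ)) = T := by
      have := congrArg (Submodule.map T.subtype) b.span_eq
      rwa [Submodule.map_span, ← Set.range_comp, Submodule.map_top, Submodule.range_subtype] at this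
    rw [hr, Set.Sum.elim_range, Submodule.span_union, hspan b, hspan b']
    exact hT'.sup_eq_top

section LocalRing

variable {A : Type*} [CommRing A] [Algebra (MvPolynomial (Fin n) ℂ) A]
  [IsLocalization.AtPrime A (vanishingIdeal ℂ {Q} : Ideal (MvPolynomial (Fin n) ℂ))]

theorem algebraMap_mem_map_iff {I : Ideal (MvPolynomial (Fin n) ℂ)} {p : MvPolynomial (Fin n) ℂ} :
    algebraMap _ A p ∈ I.map (algebraMap _ A) ↔
      p ∈ localContraction I Q := by
  rw [IsLocalization.algebraMap_mem_map_algebraMap_iff (vanishingIdeal ℂ {Q}).primeCompl]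
  simp only [mem_primeCompl_vanishingIdeal, mem_localContraction]

theorem map_localContraction (I : Ideal (MvPolynomial (Fin n) ℂ)) :
    (localContraction I Q).map (algebraMap _ A) =
      I.map (algebraMap _ A) :=
  le_antisymm (Ideal.map_le_iff_le_comap.2 fun _ hp =>
    (algebraMap_mem_map_iff (Q := Q)).2 hp)
    (Ideal.map_mono (le_localContraction I))

theorem isPrime_map_of_isPrime_localContraction {I : Ideal (MvPolynomial (Fin n) ℂ)}
    (hI : I ≤ vanishingIdeal ℂ {Q}) (hp : (localContraction I Q).IsPrime) :
    (I.map (algebraMap _ A)).IsPrime := by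
  rw [← map_localContraction (Q := Q)]
  refine IsLocalization.isPrime_of_isPrime_disjoint (vanishingIdeal ℂ {Q}).primeCompl _ _ hp ?_
  rw [Set.disjoint_left]
  exact fun p hp hpI => hp (localContraction_le_vanishingIdeal hI hpI)

theorem exists_mul_eq_algebraMap {I : Ideal (MvPolynomial (Fin n) ℂ)}
    (b : A ⧸ I.map (algebraMap _ A)) :
    ∃ p u : MvPolynomial (Fin n) ℂ, eval Q u ≠ 0 ∧
      Ideal.Quotient.mk _ (algebraMap _ A u) * b =
        Ideal.Quotient.mk _ (algebraMap _ A p) := by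
  obtain ⟨c, rfl⟩ := Ideal.Quotient.mk_surjective b
  obtain ⟨⟨p, u⟩, hc⟩ := IsLocalization.surj (vanishingIdeal ℂ {Q}).primeCompl c
  exact ⟨p, u, mem_primeCompl_vanishingIdeal.1 u.2, by rw [← map_mul, mul_comm, hc]⟩

theorem isUnit_algebraMap_of_eval_ne_zero {u : MvPolynomial (Fin n) ℂ} (hu : eval Q u ≠ 0) :
    IsUnit (algebraMap _ A u) :=
  IsLocalization.map_units (M := (vanishingIdeal ℂ {Q}).primeCompl) A
    (⟨u, mem_primeCompl_vanishingIdeal.2 hu⟩ : (vanishingIdeal ℂ {Q}).primeCompl)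

theorem maximalIdeal_quotient_map {I : Ideal (MvPolynomial (Fin n) ℂ)}
    [IsLocalRing (A ⧸ I.map (algebraMap _ A))] :
    IsLocalRing.maximalIdeal (A ⧸ I.map (algebraMap _ A)) =
      (vanishingIdeal ℂ {Q}).map ((Ideal.Quotient.mk (I.map (algebraMap _ A))).comp
        (algebraMap _ A)) := by
  have := IsLocalization.AtPrime.isLocalRing A
    (vanishingIdeal ℂ {Q} : Ideal (MvPolynomial (Fin n) ℂ))
  rw [← Ideal.map_map, IsLocalization.AtPrime.map_eq_maximalIdeal (vanishingIdeal ℂ {Q}) A]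
  have hsurj : Function.Surjective
      (Ideal.Quotient.mk (I.map (algebraMap _ A))) := Ideal.Quotient.mk_surjective
  have := hsurj.isLocalHom
  rw [← IsLocalRing.maximalIdeal_comap (Ideal.Quotient.mk (I.map (algebraMap _ A))),
    Ideal.map_comap_of_surjective _ hsurj]

/-- The embedding dimension of `V(I)` at `Q` is at least `n` minus the rank of the Jacobian. -/
theorem le_spanFinrank_add_finrank_gradientSpace {I : Ideal (MvPolynomial (Fin n) ℂ)}
    (hI : I ≤ vanishingIdeal ℂ {Q})
    [IsLocalRing (A ⧸ I.map (algebraMap _ A))] :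
    n ≤ (IsLocalRing.maximalIdeal
        (A ⧸ I.map (algebraMap _ A))).spanFinrank +
      Module.finrank ℂ (gradientSpace I Q) := by
  set 𝔪 := IsLocalRing.maximalIdeal (A ⧸ I.map (algebraMap _ A))
  set φ := (Ideal.Quotient.mk (I.map (algebraMap _ A))).comp
        (algebraMap (MvPolynomial (Fin n) ℂ) A)
  have hmax : 𝔪 = (vanishingIdeal ℂ {Q}).map φ := maximalIdeal_quotient_map
  have hfg : Submodule.FG 𝔪 := by
    rw [hmax]; exact Ideal.FG.map (IsNoetherian.noetherian (vanishingIdeal ℂ {Q})) φ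
  have hφ {v : MvPolynomial (Fin n) ℂ} (hv : eval Q v ≠ 0) : IsUnit (φ v) :=
    (isUnit_algebraMap_of_eval_ne_zero (A := A) hv).map
      (Ideal.Quotient.mk (I.map (algebraMap _ A)))
  obtain ⟨s, hs, hspan⟩ := hfg.exists_span_set_encard_eq_spanFinrank
  have hfin : s.Finite := Set.finite_of_encard_eq_coe hs
  choose P u hu hP using fun b : A ⧸ I.map (algebraMap _ A) =>
    exists_mul_eq_algebraMap (Q := Q) b
  let G := Submodule.span ℂ ((fun b => gradientAt Q (P b)) '' s) ⊔ gradientSpace I Q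
  have hIG : I ≤ gradientIdeal Q G := fun p hp =>
    ⟨mem_vanishingIdeal_point.1 (hI hp), Submodule.mem_sup_right ⟨p, hp, rfl⟩⟩
  have hsG : 𝔪 ≤ (gradientIdeal Q G).map φ := by
    rw [← hspan]
    refine Ideal.span_le.2 fun b hb => ?_
    have hb𝔪 : b ∈ 𝔪 := hspan ▸ Ideal.subset_span hb
    have hmem : φ (P b) ∈ (gradientIdeal Q G).map φ := by
      refine Ideal.mem_map_of_mem _ ⟨?_, Submodule.mem_sup_left
        (Submodule.subset_span ⟨b, hb, rfl⟩)⟩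
      by_contra hne
      have h1 : φ (P b) ∈ 𝔪 := by
        have := 𝔪.mul_mem_left (φ (u b)) hb𝔪
        rwa [show φ (u b) * b = φ (P b) from hP b] at this
      exact (IsLocalRing.mem_maximalIdeal _).1 h1 (hφ hne)
    rw [← show φ (u b) * b = φ (P b) from hP b] at hmem
    exact (Ideal.unit_mul_mem_iff_mem _ (hφ (hu b))).1 hmem
  have htop : G = ⊤ := by
    rw [eq_top_iff]
    intro w _
    rw [← Finset.univ_sum_single w]
    refine sum_mem fun i _ => ?_
    have hX : φ (X i - C (Q i)) ∈ (gradientIdeal Q G).map φ := by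
      refine hsG (hmax ▸ Ideal.mem_map_of_mem φ (mem_vanishingIdeal_point.2 (by simp)))
    rw [← Ideal.map_map, Ideal.mem_map_iff_of_surjective _ Ideal.Quotient.mk_surjective] at hX
    obtain ⟨y, hy, hyX⟩ := hX
    have hdiff := Ideal.Quotient.eq.1 hyX
    have hXG : algebraMap _ A (X i - C (Q i)) ∈
        (gradientIdeal Q G).map (algebraMap _ A) := by
      have := sub_mem hy (Ideal.map_mono hIG hdiff)
      rwa [sub_sub_cancel] at this
    obtain ⟨v, hv, -, hvG⟩ := (algebraMap_mem_map_iff (Q := Q)).1 hXG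
    have hgrad : gradientAt Q (X i - C (Q i)) = Pi.single i 1 := by
      ext j
      simp [gradientAt_apply, pderiv_X, Pi.single_apply, eq_comm, apply_ite (eval Q)]
    rw [gradientAt_mul, hgrad] at hvG
    simp only [map_sub, eval_X, eval_C, sub_self, zero_smul, add_zero] at hvG
    have := G.smul_mem (w i * (eval Q v)⁻¹) hvG
    rw [smul_smul, mul_assoc, inv_mul_cancel₀ hv, mul_one] at this
    convert this using 1
    ext j
    simp [Pi.single_apply]
  have hcard : Module.finrank ℂ (Submodule.span ℂ ((fun b => gradientAt Q (P b)) '' s)) ≤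
      Submodule.spanFinrank 𝔪 := by
    classical
    have h1 := finrank_span_finset_le_card (R := ℂ)
      (hfin.toFinset.image fun b => gradientAt Q (P b))
    rw [Finset.coe_image, hfin.coe_toFinset] at h1
    refine h1.trans (Finset.card_image_le.trans ?_)
    rw [hfin.encard_eq_coe_toFinset_card] at hs
    exact_mod_cast hs.le
  calc n = Module.finrank ℂ G := by rw [htop]; simp
    _ ≤ _ := Submodule.finrank_add_le_finrank_add_finrank _ _
    _ ≤ _ := by gcongr

namespace IsLocalFrame

variable {r d : ℕ} {h : Fin r → MvPolynomial (Fin n) ℂ} {t : Fin d → MvPolynomial (Fin n) ℂ}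

theorem ringKrullDim_quotient_le (F : IsLocalFrame Q h t) :
    ringKrullDim (A ⧸
      (Ideal.span (Set.range h)).map (algebraMap _ A)) ≤ d := by
  set H := Ideal.span (Set.range h)
  have hprime := isPrime_map_of_isPrime_localContraction (A := A) F.span_h_le F.isPrime_localContraction
  set R' := A ⧸ H.map (algebraMap _ A)
  have hsurj : Function.Surjective
      (Ideal.Quotient.mk (H.map (algebraMap _ A))) := Ideal.Quotient.mk_surjective
  have : Nontrivial R' := Ideal.Quotient.nontrivial_iff.2 hprime.ne_top
  have := IsLocalization.AtPrime.isLocalRing A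
    (vanishingIdeal ℂ {Q} : Ideal (MvPolynomial (Fin n) ℂ))
  have : IsLocalRing R' := IsLocalRing.of_surjective' _ hsurj
  have : IsNoetherianRing A :=
    IsLocalization.isNoetherianRing (vanishingIdeal ℂ {Q}).primeCompl _ inferInstance
  have : IsNoetherianRing R' := isNoetherianRing_of_surjective _ _ _ hsurj
  let φ := (Ideal.Quotient.mk (H.map (algebraMap _ A))).comp
        (algebraMap (MvPolynomial (Fin n) ℂ) A)
  have hmax : IsLocalRing.maximalIdeal R' = (vanishingIdeal ℂ {Q}).map φ :=
    maximalIdeal_quotient_map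
  have hHφ : H.map φ = ⊥ := by
    rw [← Ideal.map_map, Ideal.map_quotient_self]
  have hle : IsLocalRing.maximalIdeal R' ≤ Ideal.span (Set.range fun j => φ (t j)) := by
    refine Submodule.le_of_le_smul_of_le_jacobson_bot (I := IsLocalRing.maximalIdeal R')
      (IsNoetherian.noetherian _) (IsLocalRing.maximalIdeal_le_jacobson _) ?_
    rw [smul_eq_mul, ← pow_two]
    conv_lhs => rw [hmax]
    refine Ideal.map_le_iff_le_comap.2 fun p hp => ?_
    obtain ⟨a, b, hab⟩ := F.exists_linear hp
    have h1 := Ideal.mem_map_of_mem φ hab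
    rw [Ideal.map_pow, ← hmax] at h1
    have h2 : φ (∑ i, C (a i) * h i) = 0 := by
      have : ∑ i, C (a i) * h i ∈ H :=
        sum_mem fun i _ => H.mul_mem_left _ (Ideal.subset_span ⟨i, rfl⟩)
      simpa [hHφ] using Ideal.mem_map_of_mem φ this
    have h3 : φ (∑ j, C (b j) * t j) ∈ Ideal.span (Set.range fun j => φ (t j)) := by
      rw [map_sum]
      refine sum_mem fun j _ => ?_
      rw [map_mul]
      exact Ideal.mul_mem_left _ _ (Ideal.subset_span ⟨j, rfl⟩)
    rw [map_sub, map_add, h2, zero_add] at h1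
    rw [Ideal.mem_comap]
    have := add_mem (Ideal.mem_sup_left h3) (Ideal.mem_sup_right h1 :
      _ ∈ Ideal.span (Set.range fun j => φ (t j)) ⊔ IsLocalRing.maximalIdeal R' ^ 2)
    rwa [add_sub_cancel] at this
  have heq : IsLocalRing.maximalIdeal R' = Ideal.span (Set.range fun j => φ (t j)) := by
    refine le_antisymm hle (Ideal.span_le.2 ?_)
    rintro _ ⟨j, rfl⟩
    rw [hmax]
    exact Ideal.mem_map_of_mem φ (mem_vanishingIdeal_point.2 (F.eval_t j))
  refine (ringKrullDim_le_spanFinrank_maximalIdeal R').trans ?_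
  rw [heq]
  have : (Submodule.span R' (Set.range fun j => φ (t j))).spanFinrank ≤ d :=
    (Submodule.spanFinrank_span_le_ncard_of_finite (Set.finite_range _)).trans <| by
      rw [← Set.image_univ]
      exact (Set.ncard_image_le Set.finite_univ).trans (by simp [Set.ncard_univ])
  exact_mod_cast this

/-- A germ of dimension at least `d` inside the `d`-dimensional germ of a frame is all of it. -/
theorem le_localContraction_of_le_ringKrullDim (F : IsLocalFrame Q h t)
    {I : Ideal (MvPolynomial (Fin n) ℂ)} (hI : ∀ i, h i ∈ I)
    (hd : d ≤ ringKrullDim (A ⧸ I.map (algebraMap _ A))) :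
    I ≤ localContraction (Ideal.span (Set.range h)) Q := by
  intro p hp
  by_contra hcon
  set H := Ideal.span (Set.range h)
  have hHI : H ≤ I := Ideal.span_le.2 (by rintro _ ⟨i, rfl⟩; exact hI i)
  have hprime := isPrime_map_of_isPrime_localContraction (A := A) F.span_h_le F.isPrime_localContraction
  have hdom : IsDomain (A ⧸ H.map (algebraMap _ A)) :=
    Ideal.Quotient.isDomain _
  let x := Ideal.Quotient.mk (H.map (algebraMap _ A)) (algebraMap _ A p)
  have hx : x ≠ 0 := fun h0 =>
    hcon (algebraMap_mem_map_iff.1 (Ideal.Quotient.eq_zero_iff_mem.1 h0))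
  have h1 := ringKrullDim_quotient_succ_le_of_nonZeroDivisor (mem_nonZeroDivisors_of_ne_zero hx)
  have hfac : ∀ a ∈ Ideal.span {x}, Ideal.Quotient.factor
      (Ideal.map_mono (f := algebraMap _ A) hHI) a = 0 := by
    have : Ideal.span {x} ≤ RingHom.ker (Ideal.Quotient.factor
        (Ideal.map_mono (f := algebraMap _ A) hHI)) := by
      rw [Ideal.span_singleton_le_iff_mem, RingHom.mem_ker, Ideal.Quotient.factor_mk]
      exact Ideal.Quotient.eq_zero_iff_mem.2 (Ideal.mem_map_of_mem _ hp)
    exact fun a ha => this ha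
  have h2 := ringKrullDim_le_of_surjective _ (Ideal.Quotient.lift_surjective_of_surjective _ hfac
    (Ideal.Quotient.factor_surjective _))
  have h3 : (d : WithBot ℕ∞) + 1 ≤ d :=
    (add_le_add_left (hd.trans h2) 1).trans (h1.trans F.ringKrullDim_quotient_le)
  exact absurd h3 (by norm_cast; simp)

end IsLocalFrame

end LocalRing

end MvPolynomial

namespace PfaffianSystem

open MvPolynomial

variable {m n s : ℕ} (S : PfaffianSystem m n s)

theorem vanishingIdeal_varietyV : vanishingIdeal ℂ S.varietyV = S.idealI := by
  rw [varietyV, vanishingIdeal_zeroLocus_eq_radical, idealI, Ideal.radical_idem]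

theorem mem_varietyV_iff {z : Fin n → ℂ} : z ∈ S.varietyV ↔ ∀ k, eval z (S.g k) = 0 := by
  have hz (I : Ideal (MvPolynomial (Fin n) ℂ)) :
      z ∈ zeroLocus ℂ I ↔ I ≤ vanishingIdeal ℂ {z} := by
    rw [← le_zeroLocus_iff_le_vanishingIdeal]; simp
  rw [varietyV, hz, idealI, Ideal.IsPrime.radical_le_iff inferInstance, Ideal.span_le]
  constructor
  · exact fun h k => mem_vanishingIdeal_point.1 (h ⟨k, rfl⟩)
  · rintro h _ ⟨k, rfl⟩
    exact mem_vanishingIdeal_point.2 (h k)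

theorem g_mem_idealI (k : Fin s) : S.g k ∈ S.idealI :=
  Ideal.le_radical (Ideal.subset_span ⟨k, rfl⟩)

theorem totalDeriv_mem_idealJ (j : Fin m) {p : MvPolynomial (Fin n) ℂ} (hp : p ∈ S.idealI) :
    S.totalDeriv j p ∈ S.idealJ :=
  Ideal.le_radical (Ideal.mem_sup_right (Ideal.mem_sup_right (Ideal.subset_span ⟨j, p, hp, rfl⟩)))

theorem frobeniusIdeal_le_idealJ : S.frobeniusIdeal ≤ S.idealJ :=
  le_sup_left.trans Ideal.le_radical

/-- Where `𝕍` is regular and agrees with `𝕎` locally, `𝓘` and `𝓙` agree in the local ring. -/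
theorem idealJ_le_localContraction {Q : Fin n → ℂ} (hV : IsRegularPoint S.varietyV Q)
    (hVW : ∃ N ∈ 𝓝 Q, S.varietyV ∩ N = S.varietyW ∩ N) :
    S.idealJ ≤ localContraction S.idealI Q := by
  obtain ⟨hQ, hreg⟩ := hV
  rw [vanishingIdeal_varietyV] at hreg
  have hI : S.idealI ≤ vanishingIdeal ℂ {Q} := by
    rw [← vanishingIdeal_varietyV]
    exact vanishingIdeal_anti_mono (Set.singleton_subset_iff.2 hQ)
  have hspan := le_spanFinrank_add_finrank_gradientSpace
    (A := Localization.AtPrime (vanishingIdeal ℂ {Q})) hI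
  obtain ⟨d, h, t, F, hhI⟩ := exists_isLocalFrame hI
  have hd : (d : WithBot ℕ∞) ≤ ringKrullDim
      (Localization.AtPrime (vanishingIdeal ℂ {Q}) ⧸
        S.idealI.map (algebraMap _ (Localization.AtPrime (vanishingIdeal ℂ {Q})))) := by
    rw [← hreg.spanFinrank_maximalIdeal]
    have := F.card_eq
    exact_mod_cast (by omega : d ≤ _)
  have hle := F.le_localContraction_of_le_ringKrullDim hhI hd
  have hHI : Ideal.span (Set.range h) ≤ S.idealI :=
    Ideal.span_le.2 (by rintro _ ⟨i, rfl⟩; exact hhI i)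
  obtain ⟨ψ, hψ, hO, hψt⟩ := F.exists_parametrization
  obtain ⟨N, hN, hVN⟩ := hVW
  have hψV : ∀ᶠ x in 𝓝 0, ψ x ∈ S.varietyV := by
    simp only [mem_varietyV_iff, Filter.eventually_all]
    exact fun k => IsLocalFrame.eventually_eq_zero_of_mem_localContraction hψ
      (hψt.mono fun _ hx => hx.1) (hle (S.g_mem_idealI k))
  refine fun p hp => localContraction_mono hHI
    (F.mem_localContraction_of_eventually hψ hO hψt ?_)
  filter_upwards [hψV, hψ.eventually hN] with x hx hxN
  have : ψ x ∈ S.varietyW := (hVN ▸ ⟨hx, hxN⟩ : ψ x ∈ S.varietyW ∩ N).1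
  simpa using this p hp

theorem totalDeriv_mem_localContraction {Q : Fin n → ℂ}
    (hJ : S.idealJ ≤ localContraction S.idealI Q) (j : Fin m) {p : MvPolynomial (Fin n) ℂ}
    (hp : p ∈ localContraction S.idealI Q) :
    S.totalDeriv j p ∈ localContraction S.idealI Q := by
  obtain ⟨u, hu, hup⟩ := hp
  obtain ⟨v, hv, hvup⟩ := hJ (S.totalDeriv_mem_idealJ j hup)
  rw [totalDeriv_mul] at hvup
  refine ⟨v * u * u, by simp [hu, hv], ?_⟩
  convert sub_mem (Ideal.mul_mem_left _ u hvup)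
    (Ideal.mul_mem_left _ (v * S.totalDeriv j u) hup) using 1
  ring

end PfaffianSystem

theorem lemma2p4 {m n s : ℕ} (S : PfaffianSystem m n s) (Q : Fin n → ℂ)
    (hV : IsRegularPoint S.varietyV Q) (hW : IsRegularPoint S.varietyW Q)
    (hVW : ∃ N ∈ 𝓝 Q, S.varietyV ∩ N = S.varietyW ∩ N) :
    S.IsIntegrable ∧
      ∃ (U : Set (Fin m → ℂ)) (γ : (Fin m → ℂ) → (Fin n → ℂ)),
        S.IsSolution U γ ∧ Q ∈ γ '' U ∧ γ '' U ⊆ S.varietyW := by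
  have hJ := S.idealJ_le_localContraction hV hVW
  have hI : S.idealI ≤ MvPolynomial.vanishingIdeal ℂ {Q} := by
    rw [← S.vanishingIdeal_varietyV]
    exact MvPolynomial.vanishingIdeal_anti_mono (Set.singleton_subset_iff.2 hV.1)
  obtain ⟨U, γ, hγ, hQ, hvan⟩ := S.exists_solution_of_stable_ideal
    (fun p hp => MvPolynomial.mem_vanishingIdeal_point.1
      (MvPolynomial.localContraction_le_vanishingIdeal hI hp))
    (fun j p hp => S.totalDeriv_mem_localContraction hJ j hp)
    (S.frobeniusIdeal_le_idealJ.trans hJ)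
    (fun k => MvPolynomial.le_localContraction _ (S.g_mem_idealI k))
  refine ⟨⟨U, γ, hγ⟩, U, γ, hγ, hQ, ?_⟩
  rintro _ ⟨x, hx, rfl⟩ p hp
  simpa using hvan x hx p (hJ hp)
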